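/- Let $m,n\ge 1$ be coprime integers with $c:=m/n>1$. Let $\mathfrak h=\{x\in\mathbb C^n: x_1+\dots+x_n=0\}$, so that $\mathbb C[\mathfrak h]=\mathbb C[x_1,\dots,x_n]/(x_1+\dots+x_n)$, with the action of $W=S_n$ permuting the $x_i$. For $1\le i\le n$ let $$y_i=\frac{\partial}{\partial x_i}-c\sum_{j\ne i}\frac{1-s_{ij}}{x_i-x_j}$$ be the Dunkl operators on $\mathbb C[x_1,\dots,x_n]$, where $s_{ij}$ exchanges $x_i$ and $x_j$. They commute, and the differences $y_i-y_j$ preserve the ideal $(x_1+\dots+x_n)$ and hence act on $\mathbb C[\mathfrak h]$. Let $\Phi_c:\mathbb C[\mathfrak h]\to\mathrm{End}_{\mathbb C}(\mathbb C[\mathfrak h])$ be the algebra homomorphism with $\Phi_c(x_i-x_j)=y_i-y_j$ for all $i,j$, and let $(f,g)_c=[\Phi_c(f)g](0)$ be the Dunkl form on $\mathbb C[\mathfrak h]$. Let $\mathfrak a\subset\mathbb C[\mathfrak h]$ be the ideal generated by the $W$-invariant polynomials with zero constant term, let $\delta=\prod_{i<j}(x_i-x_j)\in\mathbb C[\mathfrak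 h]$, and let $\mathcal H_c=\mathbb C[y_1-y_2,\dots,y_{n-1}-y_n]\,\delta$ be the space obtained by applying to $\delta$ all polynomials in the operators $y_i-y_{i+1}$ on $\mathbb C[\mathfrak h]$. Then $$\mathbb C[\mathfrak h]=\mathfrak a\oplus\mathcal H_c$$ as vector spaces, $\mathfrak a$ and $\mathcal H_c$ are orthogonal for the Dunkl form, i.e. $(f,h)_c=(h,f)_c=0$ for all $f\in\mathfrak a$ and $h\in\mathcal H_c$, and $\dim_{\mathbb C}\mathcal H_c=n!$. -/

import Mathlib

open MvPolynomial
open scoped Nat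

noncomputable section

namespace Cherednik

/-! ### Dunkl operators on `ℂ[x₁, …, xₙ]` (the Cartan of `𝔤𝔩ₙ`) -/

/-- `ℂ[x₁, …, xₙ]`, the coordinate ring of the Cartan of `𝔤𝔩ₙ`. -/
abbrev Poly (n : ℕ) := MvPolynomial (Fin n) ℂ

variable {n : ℕ}

/-- The reflection `s = (i j)` acting on polynomials by exchanging `xᵢ` and `xⱼ`. -/
abbrev refl (i j : Fin n) : Poly n →ₐ[ℂ] Poly n := rename (Equiv.swap i j)

theorem sub_dvd_sub_refl (i j : Fin n) (f : Poly n) :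
    (X i - X j : Poly n) ∣ f - refl i j f := by
  rw [← Ideal.mem_span_singleton, ← Ideal.Quotient.eq]
  have hij : Ideal.Quotient.mk (Ideal.span {(X i - X j : Poly n)}) (X i)
      = Ideal.Quotient.mk _ (X j) := by
    rw [Ideal.Quotient.eq]
    exact Ideal.mem_span_singleton_self _
  have key : Ideal.Quotient.mkₐ ℂ (Ideal.span {(X i - X j : Poly n)})
      = (Ideal.Quotient.mkₐ ℂ (Ideal.span {(X i - X j : Poly n)})).comp (refl i j) := by
    apply MvPolynomial.algHom_ext
    intro k
    simp only [AlgHom.comp_apply, rename_X, Ideal.Quotient.mkₐ_eq_mk]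
    rcases eq_or_ne k i with rfl | hi
    · simpa using hij
    · rcases eq_or_ne k j with rfl | hj
      · simpa using hij.symm
      · rw [Equiv.swap_apply_of_ne_of_ne hi hj]
  exact DFunLike.congr_fun key f

theorem X_sub_X_ne_zero {i j : Fin n} (h : i ≠ j) : (X i - X j : Poly n) ≠ 0 :=
  sub_ne_zero.mpr fun e => h (X_injective e)

theorem exists_divDiff (i j : Fin n) (f : Poly n) :
    ∃ g : Poly n, (i = j → g = 0) ∧ (i ≠ j → (X i - X j) * g = f - refl i j f) := by
  rcases eq_or_ne i j with h | h
  · exact ⟨0, fun _ => rfl, fun h' => absurd h h'⟩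
  · obtain ⟨g, hg⟩ := sub_dvd_sub_refl i j f
    exact ⟨g, fun h' => absurd h' h, fun _ => hg.symm⟩

/-- The divided difference `(1 - s) f / (xᵢ - xⱼ)` with `s = (i j)`, for `i ≠ j`: the unique
polynomial `g` with `(xᵢ - xⱼ) g = f - s f`. (It is `0`, and never used, for `i = j`.) -/
def divDiff (i j : Fin n) : Poly n →ₗ[ℂ] Poly n where
  toFun f := (exists_divDiff i j f).choose
  map_add' f g := by
    rcases eq_or_ne i j with h | h
    · rw [(exists_divDiff i j _).choose_spec.1 h, (exists_divDiff i j f).choose_spec.1 h,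
        (exists_divDiff i j g).choose_spec.1 h, add_zero]
    · apply mul_left_cancel₀ (X_sub_X_ne_zero h)
      rw [mul_add, (exists_divDiff i j _).choose_spec.2 h, (exists_divDiff i j f).choose_spec.2 h,
        (exists_divDiff i j g).choose_spec.2 h, map_add]
      ring
  map_smul' a f := by
    rcases eq_or_ne i j with h | h
    · rw [(exists_divDiff i j _).choose_spec.1 h, (exists_divDiff i j f).choose_spec.1 h,
        smul_zero]
    · apply mul_left_cancel₀ (X_sub_X_ne_zero h)
      rw [RingHom.id_apply, mul_smul_comm, (exists_divDiff i j _).choose_spec.2 h,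
        (exists_divDiff i j f).choose_spec.2 h, map_smul, smul_sub]

theorem divDiff_spec {i j : Fin n} (h : i ≠ j) (f : Poly n) :
    (X i - X j) * divDiff i j f = f - refl i j f :=
  (exists_divDiff i j f).choose_spec.2 h

/-- The Dunkl operator
`yᵢ = ∂/∂xᵢ - c ∑_{j ≠ i} (1 - s_{ij}) / (xᵢ - xⱼ)` on `ℂ[x₁, …, xₙ]`. -/
def dunkl (c : ℂ) (i : Fin n) : Module.End ℂ (Poly n) :=
  (pderiv i).toLinearMap - c • ∑ j ∈ Finset.univ.erase i, divDiff i j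

theorem dunkl_apply (c : ℂ) (i : Fin n) (f : Poly n) :
    dunkl c i f = pderiv i f - c • ∑ j ∈ Finset.univ.erase i, divDiff i j f := by
  simp [dunkl]

/-! ### The relations of the rational Cherednik algebra -/

theorem rename_refl (w : Equiv.Perm (Fin n)) (i j : Fin n) (f : Poly n) :
    rename w (refl i j f) = refl (w i) (w j) (rename w f) := by
  rw [refl, refl, rename_rename, rename_rename]
  congr 2
  funext k
  rw [Equiv.swap_apply_apply]
  simp

theorem rename_divDiff (w : Equiv.Perm (Fin n)) {i j : Fin n} (h : i ≠ j) (f : Poly n) :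
    rename w (divDiff i j f) = divDiff (w i) (w j) (rename w f) := by
  have h' : w i ≠ w j := fun e => h (w.injective e)
  apply mul_left_cancel₀ (X_sub_X_ne_zero h')
  rw [divDiff_spec h', ← rename_refl, ← map_sub, ← divDiff_spec h, map_mul, map_sub, rename_X,
    rename_X]

theorem rename_dunkl (c : ℂ) (w : Equiv.Perm (Fin n)) (i : Fin n) (f : Poly n) :
    rename w (dunkl c i f) = dunkl c (w i) (rename w f) := by
  rw [dunkl_apply, dunkl_apply, map_sub, map_smul, map_sum, pderiv_rename w.injective]
  congr 2
  refine Finset.sum_bij (fun j _ => w j) ?_ ?_ ?_ ?_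
  · intro j hj
    simpa using hj
  · intro j _ k _ e
    exact w.injective e
  · intro k hk
    refine ⟨w.symm k, ?_, by simp⟩
    simp only [Finset.mem_erase, Finset.mem_univ, and_true, ne_eq] at hk ⊢
    rintro rfl
    simp at hk
  · intro j hj
    exact rename_divDiff w (Finset.ne_of_mem_erase hj).symm f

/-- The commutator `[yᵢ, x_k]`, an element of the group algebra of `Sₙ`. -/
def bracket (c : ℂ) (i k : Fin n) : Module.End ℂ (Poly n) :=
  if k = i then 1 - c • ∑ j ∈ Finset.univ.erase i, (refl i j).toLinearMap
  else c • (refl i k).toLinearMap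

theorem divDiff_X_mul {i j : Fin n} (h : i ≠ j) (k : Fin n) (f : Poly n) :
    divDiff i j (X k * f) = X k * divDiff i j f
      + (if k = i then refl i j f else 0) - (if k = j then refl i j f else 0) := by
  apply mul_left_cancel₀ (X_sub_X_ne_zero h)
  have e := divDiff_spec h f
  have e' := divDiff_spec h (X k * f)
  rw [map_mul (refl i j), rename_X] at e'
  rcases eq_or_ne k i with rfl | hi
  · rw [Equiv.swap_apply_left] at e'
    rw [if_pos rfl, if_neg h]
    linear_combination e' - X k * e
  · rcases eq_or_ne k j with rfl | hj
    · rw [Equiv.swap_apply_right] at e'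
      rw [if_pos rfl, if_neg hi]
      linear_combination e' - X k * e
    · rw [Equiv.swap_apply_of_ne_of_ne hi hj] at e'
      rw [if_neg hi, if_neg hj]
      linear_combination e' - X k * e

theorem dunkl_X_mul (c : ℂ) (i k : Fin n) (f : Poly n) :
    dunkl c i (X k * f) = X k * dunkl c i f + bracket c i k f := by
  have hs : ∑ j ∈ Finset.univ.erase i, divDiff i j (X k * f)
      = X k * ∑ j ∈ Finset.univ.erase i, divDiff i j f
        + (∑ j ∈ Finset.univ.erase i, (if k = i then refl i j f else 0)
          - ∑ j ∈ Finset.univ.erase i, (if k = j then refl i j f else 0)) := by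
    rw [Finset.mul_sum, ← Finset.sum_sub_distrib, ← Finset.sum_add_distrib]
    refine Finset.sum_congr rfl fun j hj => ?_
    rw [divDiff_X_mul (Finset.ne_of_mem_erase hj).symm, add_sub_assoc]
  rw [dunkl_apply, dunkl_apply, hs, Derivation.leibniz, pderiv_X, Finset.sum_ite_eq, bracket]
  rcases eq_or_ne k i with rfl | hk
  · simp [smul_add, mul_sub]
    ring
  · simp [hk, mul_sub, smul_add, smul_sub]
    ring

theorem dunkl_C (c : ℂ) (i : Fin n) (a : ℂ) : dunkl c i (C a : Poly n) = 0 := by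
  rw [dunkl_apply, pderiv_C, Finset.sum_eq_zero, smul_zero, sub_zero]
  intro j hj
  have h := (Finset.ne_of_mem_erase hj).symm
  apply mul_left_cancel₀ (X_sub_X_ne_zero h)
  rw [divDiff_spec h]
  simp

theorem refl_dunkl (c : ℂ) (a b i : Fin n) (f : Poly n) :
    refl a b (dunkl c i f) = dunkl c (Equiv.swap a b i) (refl a b f) :=
  rename_dunkl c _ i f

theorem bracket_dunkl (c : ℂ) {i j : Fin n} (hij : i ≠ j) (f : Poly n) :
    bracket c i i (dunkl c j f) - dunkl c j (bracket c i i f)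
      = c • (dunkl c j (refl i j f) - dunkl c i (refl i j f)) := by
  have h1 : ∀ g, bracket c i i g = g - c • ∑ l ∈ Finset.univ.erase i, refl i l g := by
    intro g; simp [bracket]
  have hj : j ∈ Finset.univ.erase i := by simp [hij.symm]
  have h2 : ∑ l ∈ (Finset.univ.erase i).erase j, refl i l (dunkl c j f)
      = ∑ l ∈ (Finset.univ.erase i).erase j, dunkl c j (refl i l f) := by
    refine Finset.sum_congr rfl fun l hl => ?_
    rw [refl_dunkl, Equiv.swap_apply_of_ne_of_ne hij.symm (Finset.ne_of_mem_erase hl).symm]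
  rw [h1, h1, map_sub, map_smul, map_sum, ← Finset.add_sum_erase _ _ hj,
    ← Finset.add_sum_erase _ _ hj, h2, refl_dunkl, Equiv.swap_apply_right, smul_add, smul_add,
    smul_sub]
  abel

/-- Dunkl operators commute. -/
theorem dunkl_comm (c : ℂ) (i j : Fin n) (f : Poly n) :
    dunkl c i (dunkl c j f) = dunkl c j (dunkl c i f) := by
  rcases eq_or_ne i j with rfl | hij
  · rfl
  induction f using MvPolynomial.induction_on with
  | C a => simp [dunkl_C]
  | add p q hp hq => simp [hp, hq]
  | mul_X p k hp =>
    have key : bracket c i k (dunkl c j p) - dunkl c j (bracket c i k p)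
        = bracket c j k (dunkl c i p) - dunkl c i (bracket c j k p) := by
      have far : ∀ a b : Fin n, k ≠ a → k ≠ b → a ≠ b →
          bracket c a k (dunkl c b p) - dunkl c b (bracket c a k p) = 0 := by
        intro a b ha hb hab
        simp only [bracket, if_neg ha, LinearMap.smul_apply, AlgHom.toLinearMap_apply]
        rw [refl_dunkl, Equiv.swap_apply_of_ne_of_ne hab.symm hb.symm, map_smul, sub_self]
      have near : ∀ a b : Fin n, a ≠ b →
          bracket c b a (dunkl c a p) - dunkl c a (bracket c b a p)
            = c • (dunkl c b (refl a b p) - dunkl c a (refl a b p)) := by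
        intro a b hab
        simp only [bracket, if_neg hab, LinearMap.smul_apply, AlgHom.toLinearMap_apply]
        rw [refl_dunkl, Equiv.swap_apply_right, map_smul, smul_sub]
        simp only [refl, Equiv.swap_comm b a]
      rcases eq_or_ne k i with rfl | hi
      · rw [bracket_dunkl c hij, near _ _ hij]
      · rcases eq_or_ne k j with rfl | hj
        · rw [bracket_dunkl c hij.symm, near _ _ hij.symm]
        · rw [far i j hi hj hij, far j i hj hi hij.symm]
    rw [mul_comm, dunkl_X_mul, dunkl_X_mul, map_add, map_add, dunkl_X_mul, dunkl_X_mul, hp]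
    linear_combination key

/-! ### The coordinate ring of `𝔥`, the Cartan of `𝔰𝔩ₙ` -/

/-- The ideal of `𝔥 = {x₁ + ⋯ + xₙ = 0}` in `ℂ[x₁, …, xₙ]`. -/
def traceIdeal (n : ℕ) : Ideal (Poly n) := Ideal.span {∑ i, X i}

/-- The coordinate ring `ℂ[𝔥] = ℂ[x₁, …, xₙ] / (x₁ + ⋯ + xₙ)`. -/
abbrev CoordRing (n : ℕ) := Poly n ⧸ traceIdeal n

/-- Restriction of polynomial functions, `ℂ[x₁, …, xₙ] → ℂ[𝔥]`. -/
abbrev res (n : ℕ) : Poly n →ₐ[ℂ] CoordRing n := Ideal.Quotient.mkₐ ℂ (traceIdeal n)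

theorem res_surjective (n : ℕ) : Function.Surjective (res n) :=
  Ideal.Quotient.mkₐ_surjective ℂ _

/-- Value at the origin of a polynomial function on `𝔥`. -/
def evalZero (n : ℕ) : CoordRing n →ₐ[ℂ] ℂ :=
  Ideal.Quotient.liftₐ (traceIdeal n) (aeval fun _ => (0 : ℂ)) fun f hf => by
    have h : traceIdeal n ≤ RingHom.ker (aeval fun _ : Fin n => (0 : ℂ)) := by
      rw [traceIdeal, Ideal.span_singleton_le_iff_mem, RingHom.mem_ker]
      simp
    exact h hf

/-- The action of `w ∈ W = Sₙ` on `ℂ[𝔥]`, with `w xᵢ = x_{w(i)}`. -/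
def permAct (w : Equiv.Perm (Fin n)) : CoordRing n →ₐ[ℂ] CoordRing n :=
  Ideal.quotientMapₐ (traceIdeal n) (rename w) (by
    rw [traceIdeal, Ideal.span_singleton_le_iff_mem, Ideal.mem_comap, map_sum]
    simp only [rename_X]
    rw [Equiv.sum_comp w (fun i => (X i : Poly n))]
    exact Ideal.mem_span_singleton_self _)

/-- The ideal `𝔞 ⊆ ℂ[𝔥]` generated by the `W`-invariants without constant term. -/
def invariantIdeal (n : ℕ) : Ideal (CoordRing n) :=
  Ideal.span {f | (∀ w : Equiv.Perm (Fin n), permAct w f = f) ∧ evalZero n f = 0}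

/-- The Vandermonde determinant `δ = ∏_{i < j} (xᵢ - xⱼ)` in `ℂ[𝔥]`. -/
def vandermonde (n : ℕ) : CoordRing n :=
  ∏ i : Fin n, ∏ j ∈ Finset.Ioi i, res n (X i - X j)

/-! ### Dunkl operators on `ℂ[𝔥]` -/

theorem dunkl_sum_X_mul (c : ℂ) (i : Fin n) (f : Poly n) :
    dunkl c i ((∑ k, X k) * f) = (∑ k, X k) * dunkl c i f + f := by
  rw [Finset.sum_mul, map_sum]
  simp only [dunkl_X_mul]
  rw [Finset.sum_add_distrib, ← Finset.sum_mul,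
    ← Finset.add_sum_erase Finset.univ (fun k => bracket c i k f) (Finset.mem_univ i)]
  have h : ∑ k ∈ Finset.univ.erase i, bracket c i k f
      = c • ∑ k ∈ Finset.univ.erase i, refl i k f := by
    rw [Finset.smul_sum]
    refine Finset.sum_congr rfl fun k hk => ?_
    simp [bracket, Finset.ne_of_mem_erase hk]
  rw [h]
  simp [bracket]

theorem dunkl_sub_mem (c : ℂ) (i j : Fin n) {f : Poly n} (hf : f ∈ traceIdeal n) :
    (dunkl c i - dunkl c j) f ∈ traceIdeal n := by
  obtain ⟨g, rfl⟩ := Ideal.mem_span_singleton.mp hf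
  rw [LinearMap.sub_apply, dunkl_sum_X_mul, dunkl_sum_X_mul, add_sub_add_right_eq_sub, ← mul_sub]
  exact Ideal.mul_mem_right _ _ (Ideal.mem_span_singleton_self _)

/-- The operator `yᵢ - yⱼ` on `ℂ[𝔥]`, induced by the one on `ℂ[x₁, …, xₙ]`. -/
def dunklSub (c : ℂ) (i j : Fin n) : Module.End ℂ (CoordRing n) :=
  (Submodule.Quotient.restrictScalarsEquiv ℂ (traceIdeal n)).conj
    (Submodule.mapQ ((traceIdeal n).restrictScalars ℂ) ((traceIdeal n).restrictScalars ℂ)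
      (dunkl c i - dunkl c j) fun _ hf => dunkl_sub_mem c i j hf)

theorem dunklSub_res (c : ℂ) (i j : Fin n) (f : Poly n) :
    dunklSub c i j (res n f) = res n (dunkl c i f - dunkl c j f) := rfl

/-- The image of `yᵢ` in `H_c`: the operator `yᵢ - (1/n) ∑ⱼ yⱼ = (1/n) ∑ⱼ (yᵢ - yⱼ)` on `ℂ[𝔥]`. -/
def dunklBar (c : ℂ) (i : Fin n) : Module.End ℂ (CoordRing n) :=
  (n : ℂ)⁻¹ • ∑ j, dunklSub c i j

theorem dunklSub_comm (c : ℂ) (i j k l : Fin n) :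
    Commute (dunklSub c i j) (dunklSub c k l) := by
  apply LinearMap.ext
  intro f
  obtain ⟨f, rfl⟩ := res_surjective n f
  rw [Module.End.mul_apply, Module.End.mul_apply, dunklSub_res, dunklSub_res, dunklSub_res,
    dunklSub_res]
  refine congrArg (res n) ?_
  simp only [map_sub, dunkl_comm c k, dunkl_comm c l]
  abel

theorem dunklBar_comm (c : ℂ) (i j : Fin n) : Commute (dunklBar c i) (dunklBar c j) := by
  refine Commute.smul_left (Commute.smul_right ?_ _) _
  exact Commute.sum_left _ _ _ fun k _ => Commute.sum_right _ _ _ fun l _ => dunklSub_comm c i k j l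

theorem dunklBar_sub (c : ℂ) (i j : Fin n) : dunklBar c i - dunklBar c j = dunklSub c i j := by
  have hn : (n : ℂ) ≠ 0 := by
    have := i.pos
    exact_mod_cast this.ne'
  have h : ∀ k, dunklSub c i k - dunklSub c j k = dunklSub c i j := by
    intro k
    apply LinearMap.ext
    intro f
    obtain ⟨f, rfl⟩ := res_surjective n f
    rw [LinearMap.sub_apply, dunklSub_res, dunklSub_res, dunklSub_res, ← map_sub]
    refine congrArg (res n) ?_
    abel
  rw [dunklBar, dunklBar, ← smul_sub (n : ℂ)⁻¹ (∑ k, dunklSub c i k) (∑ k, dunklSub c j k), ← Finset.sum_sub_distrib, Finset.sum_congr rfl fun k _ => h k,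
    Finset.sum_const, Finset.card_univ, Fintype.card_fin, ← Nat.cast_smul_eq_nsmul ℂ, smul_smul,
    inv_mul_cancel₀ hn, one_smul]

theorem sum_dunklBar (c : ℂ) : ∑ i : Fin n, dunklBar c i = 0 := by
  simp only [dunklBar]
  rw [← Finset.smul_sum]
  have h : ∑ i : Fin n, ∑ j : Fin n, dunklSub c i j = 0 := by
    apply LinearMap.ext
    intro f
    obtain ⟨f, rfl⟩ := res_surjective n f
    simp only [LinearMap.sum_apply, dunklSub_res, map_sub, Finset.sum_sub_distrib,
      LinearMap.zero_apply]
    rw [Finset.sum_comm, sub_self]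
  rw [h, smul_zero]

/-- Substitution of the commuting operators `dunklBar c i` for the variables `xᵢ`. -/
def fourierPoly (n : ℕ) (c : ℂ) : Poly n →ₐ[ℂ] Module.End ℂ (CoordRing n) :=
  letI : CommSemiring (Algebra.adjoin ℂ (Set.range (dunklBar (n := n) c))) :=
    { (inferInstance : Semiring (Algebra.adjoin ℂ (Set.range (dunklBar (n := n) c)))) with
      mul_comm := (Algebra.isMulCommutative_adjoin ℂ (by
        rintro _ ⟨i, rfl⟩ _ ⟨j, rfl⟩
        exact dunklBar_comm c i j)).is_comm.comm }
  (Algebra.adjoin ℂ (Set.range (dunklBar (n := n) c))).val.comp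
    (aeval (S₁ := Algebra.adjoin ℂ (Set.range (dunklBar (n := n) c)))
      fun i => ⟨dunklBar c i, Algebra.subset_adjoin ⟨i, rfl⟩⟩)

theorem fourierPoly_X (c : ℂ) (i : Fin n) : fourierPoly n c (X i) = dunklBar c i := by
  simp [fourierPoly]

/-- The map `Φ_c` on `ℂ[𝔥]`, with values in operators on `ℂ[𝔥]`: the algebra homomorphism
determined by `Φ_c (xᵢ - xⱼ) = yᵢ - yⱼ` (see `fourier_sub`). -/
def fourier (n : ℕ) (c : ℂ) : CoordRing n →ₐ[ℂ] Module.End ℂ (CoordRing n) :=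
  Ideal.Quotient.liftₐ (traceIdeal n) (fourierPoly n c) fun f hf => by
    obtain ⟨g, rfl⟩ := Ideal.mem_span_singleton.mp hf
    rw [map_mul, map_sum]
    simp only [fourierPoly_X]
    rw [sum_dunklBar, zero_mul]

theorem fourier_sub (c : ℂ) (i j : Fin n) :
    fourier n c (res n (X i - X j)) = dunklSub c i j := by
  rw [← dunklBar_sub, ← fourierPoly_X, ← fourierPoly_X, ← map_sub]
  rfl

/-- The Dunkl bilinear form `(f, g)_c = [Φ_c(f) g](0)` on `ℂ[𝔥]`. -/
def dunklForm (n : ℕ) (c : ℂ) : LinearMap.BilinForm ℂ (CoordRing n) :=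
  (fourier n c).toLinearMap.compr₂ (evalZero n).toLinearMap

theorem dunklForm_apply (c : ℂ) (f g : CoordRing n) :
    dunklForm n c f g = evalZero n (fourier n c f g) := rfl

/-- The commutative algebra `ℂ[y₁ - y₂, …, yₙ₋₁ - yₙ]` of operators on `ℂ[𝔥]`. -/
def dunklAlgebra (n : ℕ) (c : ℂ) : Subalgebra ℂ (Module.End ℂ (CoordRing n)) :=
  Algebra.adjoin ℂ {D | ∃ i j : Fin n, (i : ℕ) + 1 = j ∧ D = dunklSub c i j}

/-- The space `ℋ_c = ℂ[y₁ - y₂, …, yₙ₋₁ - yₙ] δ` of `c`-harmonic polynomials. -/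
def harmonic (n : ℕ) (c : ℂ) : Submodule ℂ (CoordRing n) :=
  (Subalgebra.toSubmodule (dunklAlgebra n c)).map (LinearMap.applyₗ (vandermonde n))

theorem mem_harmonic (c : ℂ) (f : CoordRing n) :
    f ∈ harmonic n c ↔ ∃ D ∈ dunklAlgebra n c, D (vandermonde n) = f := Iff.rfl

end Cherednik

end

noncomputable section

namespace Cherednik

variable {n : ℕ}

/-! Write `Yᵢ` for `dunklBar c i`, `N = n(n-1)/2` for the degree of `δ`, and `Φ` for `fourier`.
Everything is read off from the map `f ↦ Φ(f)δ`, whose image is `ℋ_c`.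

Orthogonality. If `p` is invariant and homogeneous of positive degree, `Φ(p)δ` is antisymmetric of
degree below `N`, hence zero; so `𝔞` kills `δ` (`fourier_vandermonde_eq_zero`). Since `Φ` has
commutative image, `(f, Φ(g)δ) = (g, Φ(f)δ) = 0` for `f ∈ 𝔞`. Commutators `[Yᵢ, x_k]` that are
self-adjoint and symmetric in `i, k` make the form symmetric (`dunklForm_comm`), which gives the
other order.

Definiteness. On the real part of `ℋ_c` in degree `d`, the form times `(-1)^d` is positive definite
(`dunklForm_definite`). Let `F = Φ(q)δ`, with `q` real homogeneous of degree `k = N - d`, and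
suppose that `∑_{i≠j} s_{ij} q = a q` (ordered pairs). As `s_{ij}F = -Φ(s_{ij}q)δ`, the deformed
Euler identity says that `∑ xᵢYᵢ` multiplies `F` by `d - (c/2)(2N + a)`. A sum-of-squares argument
on coefficient vectors gives `a ≥ -2k` (`sum_comp_swap_nonneg`), so this scalar is at most `(1 -
c)d`, negative for `d > 0`. Since `xᵢ` and `Yᵢ` are adjoint, the scalar times `(F, F)` equals `∑
(YᵢF, YᵢF)`, and `YᵢF = Φ(xᵢq)δ` lies one degree lower: each degree flips the sign. Consequently `𝔞
∩ ℋ_c = 0` and `(δ, δ) ≠ 0`.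

Dimension. The monomials below the staircase span the polynomials over the invariants, and
`dualCoeff` is the dual family for the pairing `alt(fg)/δ`. Modulo `𝔞` this pairing is, up to a
nonzero factor, `(fg, δ)`. Hence the `n!` vectors `Φ(x^β)δ` form a basis of `ℋ_c`, and the kernel of
`f ↦ Φ(f)δ` is exactly `𝔞`. Restricted to the finite-dimensional `ℋ_c` this map is injective, hence
onto, which gives `𝔞 + ℋ_c = ℂ[𝔥]`. -/

/-! ### Operators induced on `ℂ[𝔥]` and their commutators -/

theorem permAct_res (w : Equiv.Perm (Fin n)) (f : Poly n) :
    permAct w (res n f) = res n (rename w f) := rfl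

theorem evalZero_res (f : Poly n) : evalZero n (res n f) = constantCoeff f := by
  exact MvPolynomial.aeval_zero' f

theorem permAct_permAct (v w : Equiv.Perm (Fin n)) (f : CoordRing n) :
    permAct v (permAct w f) = permAct (v * w) f := by
  obtain ⟨f, rfl⟩ := res_surjective n f
  rw [permAct_res, permAct_res, permAct_res, rename_rename]
  rfl

theorem evalZero_permAct (w : Equiv.Perm (Fin n)) (f : CoordRing n) :
    evalZero n (permAct w f) = evalZero n f := by
  obtain ⟨f, rfl⟩ := res_surjective n f
  rw [permAct_res, evalZero_res, evalZero_res, constantCoeff_rename]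

theorem sum_res_X : ∑ i, res n (X i) = 0 := by
  rw [← map_sum, Ideal.Quotient.mkₐ_eq_mk, Ideal.Quotient.eq_zero_iff_mem]
  exact Ideal.mem_span_singleton_self _

theorem dunklBar_res (c : ℂ) (i : Fin n) (f : Poly n) :
    dunklBar c i (res n f) = res n (dunkl c i f - (n : ℂ)⁻¹ • ∑ j, dunkl c j f) := by
  have hn : (n : ℂ) ≠ 0 := by exact_mod_cast i.pos.ne'
  simp only [dunklBar, LinearMap.smul_apply, LinearMap.sum_apply, dunklSub_res]
  rw [← map_sum, ← map_smul, Finset.sum_sub_distrib, smul_sub, Finset.sum_const, Finset.card_univ,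
    Fintype.card_fin, ← Nat.cast_smul_eq_nsmul ℂ, smul_smul, inv_mul_cancel₀ hn, one_smul]

theorem dunklBar_one (c : ℂ) (i : Fin n) : dunklBar c i (1 : CoordRing n) = 0 := by
  have h : ∀ j : Fin n, dunkl c j (1 : Poly n) = 0 := fun j => by
    simpa using dunkl_C c j 1
  rw [← map_one (res n), dunklBar_res]
  simp [h]

theorem permAct_dunklBar (c : ℂ) (w : Equiv.Perm (Fin n)) (i : Fin n) (f : CoordRing n) :
    permAct w (dunklBar c i f) = dunklBar c (w i) (permAct w f) := by
  obtain ⟨f, rfl⟩ := res_surjective n f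
  rw [permAct_res, dunklBar_res, dunklBar_res, permAct_res, map_sub, map_smul, map_sum]
  simp only [rename_dunkl]
  rw [Equiv.sum_comp w fun j => dunkl c j (rename w f)]

/-- The commutator `[Yᵢ, x_k]` on `ℂ[𝔥]`. -/
def bracketBar (c : ℂ) (i k : Fin n) : Module.End ℂ (CoordRing n) :=
  (if k = i then 1 - c • ∑ j ∈ Finset.univ.erase i, (permAct (Equiv.swap i j)).toLinearMap
    else c • (permAct (Equiv.swap i k)).toLinearMap) - (n : ℂ)⁻¹ • 1

/-- The reflection terms of `[y_k, x_k]` cancel those of the other `[y_j, x_k]`. This is why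
replacing `yᵢ` by `Yᵢ` changes a commutator only by the scalar `1/n`. -/
theorem sum_bracket (c : ℂ) (k : Fin n) (f : Poly n) : ∑ j, bracket c j k f = f := by
  rw [← Finset.add_sum_erase Finset.univ _ (Finset.mem_univ k)]
  have h : ∑ j ∈ Finset.univ.erase k, bracket c j k f
      = c • ∑ j ∈ Finset.univ.erase k, refl k j f := by
    rw [Finset.smul_sum]
    refine Finset.sum_congr rfl fun j hj => ?_
    simp [bracket, (Finset.ne_of_mem_erase hj).symm, refl, Equiv.swap_comm j k]
  rw [h]
  simp [bracket]

theorem res_bracket (c : ℂ) (i k : Fin n) (f : Poly n) :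
    res n (bracket c i k f - (n : ℂ)⁻¹ • f) = bracketBar c i k (res n f) := by
  rw [bracket, bracketBar, map_sub, map_smul]
  split_ifs with h
  · simp only [LinearMap.sub_apply, LinearMap.smul_apply, LinearMap.sum_apply,
      AlgHom.toLinearMap_apply, Module.End.one_apply, permAct_res, map_sub, map_smul, map_sum]
  · simp only [LinearMap.sub_apply, LinearMap.smul_apply,
      AlgHom.toLinearMap_apply, Module.End.one_apply, permAct_res, map_smul]

theorem bracketBar_comm (c : ℂ) (i k : Fin n) :
    bracketBar c i k = bracketBar c k i := by
  rcases eq_or_ne k i with rfl | h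
  · rfl
  · rw [bracketBar, bracketBar, if_neg h, if_neg h.symm, Equiv.swap_comm]

theorem dunklBar_X_mul (c : ℂ) (i k : Fin n) (f : CoordRing n) :
    dunklBar c i (res n (X k) * f) = res n (X k) * dunklBar c i f + bracketBar c i k f := by
  obtain ⟨f, rfl⟩ := res_surjective n f
  rw [← map_mul, dunklBar_res, dunklBar_res, ← map_mul, ← res_bracket, ← map_add]
  refine congrArg (res n) ?_
  simp only [dunkl_X_mul, Finset.sum_add_distrib, sum_bracket, ← Finset.mul_sum]
  rw [smul_add, mul_sub, mul_smul_comm]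
  abel

/-! ### The deformed Euler identity -/

theorem divDiff_swap (i j : Fin n) (f : Poly n) : divDiff j i f = - divDiff i j f := by
  rcases eq_or_ne i j with rfl | h
  · have : divDiff i i f = 0 := (exists_divDiff i i f).choose_spec.1 rfl
    rw [this, neg_zero]
  · apply mul_left_cancel₀ (X_sub_X_ne_zero h)
    have h1 := divDiff_spec h f
    have h2 := divDiff_spec h.symm f
    have h3 : refl j i f = refl i j f := by rw [refl, Equiv.swap_comm]
    rw [h3] at h2
    linear_combination h1 - h2

theorem divDiff_self (i : Fin n) (f : Poly n) : divDiff i i f = 0 :=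
  (exists_divDiff i i f).choose_spec.1 rfl

theorem dunkl_apply' (c : ℂ) (i : Fin n) (f : Poly n) :
    dunkl c i f = pderiv i f - c • ∑ j, divDiff i j f := by
  rw [dunkl_apply, Finset.sum_erase (f := fun j => divDiff i j f) _ (divDiff_self i f)]

theorem X_sub_X_mul_divDiff (i j : Fin n) (f : Poly n) :
    (X i - X j) * divDiff i j f = f - refl i j f := by
  rcases eq_or_ne i j with rfl | h
  · simp [refl]
  · exact divDiff_spec h f

/-- The deformed Euler identity. -/
theorem sum_X_mul_dunkl (c : ℂ) {d : ℕ} {f : Poly n} (hf : f.IsHomogeneous d) :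
    ∑ i, X i * dunkl c i f = d • f - (c / 2) • ∑ i, ∑ j, (f - refl i j f) := by
  have h : ∑ i : Fin n, ∑ j, X i * divDiff i j f
      = (1 / 2 : ℂ) • ∑ i, ∑ j, (f - refl i j f) := by
    -- Antisymmetry of the divided difference in `i, j` allows averaging `xᵢ` with `-xⱼ`, which
    -- cancels the denominator.
    have h2 : ∑ i : Fin n, ∑ j, X i * divDiff i j f
        = - ∑ i : Fin n, ∑ j, X j * divDiff i j f := by
      rw [Finset.sum_comm, ← Finset.sum_neg_distrib]
      refine Finset.sum_congr rfl fun i _ => ?_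
      rw [← Finset.sum_neg_distrib]
      refine Finset.sum_congr rfl fun j _ => ?_
      rw [divDiff_swap, mul_neg]
    have h3 : ∑ i : Fin n, ∑ j, (f - refl i j f)
        = (2 : ℂ) • ∑ i : Fin n, ∑ j, X i * divDiff i j f := by
      rw [two_smul]
      nth_rw 2 [h2]
      rw [← sub_eq_add_neg, ← Finset.sum_sub_distrib]
      refine Finset.sum_congr rfl fun i _ => ?_
      rw [← Finset.sum_sub_distrib]
      refine Finset.sum_congr rfl fun j _ => ?_
      rw [← X_sub_X_mul_divDiff, sub_mul]
    rw [h3, smul_smul]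
    norm_num
  have h4 : c / 2 = c * (1 / 2) := by ring
  rw [h4, mul_smul, ← h, ← hf.sum_X_mul_pderiv, Finset.smul_sum, ← Finset.sum_sub_distrib]
  refine Finset.sum_congr rfl fun i _ => ?_
  rw [dunkl_apply', mul_sub, mul_smul_comm, Finset.mul_sum]

/-- The mean of the `yⱼ` subtracted in `Yᵢ` drops out because `∑ xᵢ = 0` on `𝔥`, so the identity
descends unchanged. -/
theorem sum_X_mul_dunklBar (c : ℂ) {d : ℕ} {f : Poly n} (hf : f.IsHomogeneous d) :
    ∑ i, res n (X i) * dunklBar c i (res n f)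
      = (d : ℂ) • res n f
        - (c / 2) • ∑ i, ∑ j, (res n f - permAct (Equiv.swap i j) (res n f)) := by
  have h : ∑ i, res n (X i) * dunklBar c i (res n f) = res n (∑ i, X i * dunkl c i f) := by
    simp only [dunklBar_res, map_sub, mul_sub, Finset.sum_sub_distrib]
    rw [← Finset.sum_mul, sum_res_X, zero_mul, sub_zero, map_sum]
    simp only [map_mul]
  rw [h, sum_X_mul_dunkl c hf, map_sub, map_nsmul, map_smul, Nat.cast_smul_eq_nsmul]
  simp only [map_sum, map_sub, permAct_res]

/-! ### The Dunkl form -/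

theorem fourier_res (c : ℂ) (f : Poly n) : fourier n c (res n f) = fourierPoly n c f := rfl

theorem fourier_X (c : ℂ) (i : Fin n) : fourier n c (res n (X i)) = dunklBar c i := by
  rw [fourier_res, fourierPoly_X]

theorem fourier_mul_apply (c : ℂ) (f g h : CoordRing n) :
    fourier n c (f * g) h = fourier n c f (fourier n c g h) := by
  rw [map_mul, Module.End.mul_apply]

theorem CoordRing.induction {P : CoordRing n → Prop} (hC : ∀ a : ℂ, P (algebraMap ℂ _ a))
    (hadd : ∀ f g, P f → P g → P (f + g)) (hX : ∀ k f, P f → P (res n (X k) * f))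
    (f : CoordRing n) : P f := by
  obtain ⟨f, rfl⟩ := res_surjective n f
  induction f using MvPolynomial.induction_on with
  | C a => exact hC a
  | add p q hp hq => rw [map_add]; exact hadd _ _ hp hq
  | mul_X p k hp => rw [map_mul, mul_comm]; exact hX k _ hp

theorem permAct_fourier (c : ℂ) (w : Equiv.Perm (Fin n)) (f g : CoordRing n) :
    permAct w (fourier n c f g) = fourier n c (permAct w f) (permAct w g) := by
  induction f using CoordRing.induction generalizing g with
  | hC a => simp [Module.algebraMap_end_apply]
  | hadd p q hp hq => simp only [map_add, LinearMap.add_apply, hp, hq]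
  | hX k p hp =>
    rw [fourier_mul_apply, fourier_X, permAct_dunklBar, hp, map_mul, fourier_mul_apply,
      permAct_res, rename_X, fourier_X]

theorem dunklForm_permAct (c : ℂ) (w : Equiv.Perm (Fin n)) (f g : CoordRing n) :
    dunklForm n c (permAct w f) (permAct w g) = dunklForm n c f g := by
  rw [dunklForm_apply, ← permAct_fourier, evalZero_permAct, dunklForm_apply]

theorem dunklForm_mul_left (c : ℂ) (f g h : CoordRing n) :
    dunklForm n c (f * g) h = dunklForm n c f (fourier n c g h) := by
  rw [dunklForm_apply, fourier_mul_apply, dunklForm_apply]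

theorem dunklForm_X_mul_left (c : ℂ) (i : Fin n) (f g : CoordRing n) :
    dunklForm n c (res n (X i) * f) g = dunklForm n c f (dunklBar c i g) := by
  rw [mul_comm, dunklForm_mul_left, fourier_X]

theorem dunklForm_swap (c : ℂ) (i j : Fin n) (f g : CoordRing n) :
    dunklForm n c (permAct (Equiv.swap i j) f) g
      = dunklForm n c f (permAct (Equiv.swap i j) g) := by
  rw [← dunklForm_permAct c (Equiv.swap i j), permAct_permAct, Equiv.swap_mul_self]
  congr 1
  obtain ⟨f, rfl⟩ := res_surjective n f
  rw [permAct_res, Equiv.Perm.coe_one, rename_id_apply]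

theorem dunklForm_bracketBar (c : ℂ) (i k : Fin n) (f g : CoordRing n) :
    dunklForm n c (bracketBar c i k f) g = dunklForm n c f (bracketBar c i k g) := by
  rw [bracketBar]
  split_ifs with h
  · simp only [LinearMap.sub_apply, LinearMap.smul_apply, LinearMap.sum_apply,
      AlgHom.toLinearMap_apply, Module.End.one_apply, map_sub, map_smul, map_sum, dunklForm_swap]
  · simp only [LinearMap.sub_apply, LinearMap.smul_apply,
      AlgHom.toLinearMap_apply, Module.End.one_apply, map_sub, map_smul, dunklForm_swap]

theorem dunklForm_algebraMap_left (c a : ℂ) (g : CoordRing n) :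
    dunklForm n c (algebraMap ℂ _ a) g = a * evalZero n g := by
  rw [dunklForm_apply, AlgHom.commutes, Module.algebraMap_end_apply, map_smul, smul_eq_mul]

theorem evalZero_X_mul (i : Fin n) (f : CoordRing n) : evalZero n (res n (X i) * f) = 0 := by
  rw [map_mul, evalZero_res, constantCoeff_X, zero_mul]

/-- Adjointness in the second argument is not built into the form. In the inductive step both sides
reduce to `(Yᵢp, Y_k g)` plus a commutator term, and these terms agree because `[Yᵢ, x_k]` is
self-adjoint and symmetric in `i, k`. -/
theorem dunklForm_X_mul_right (c : ℂ) (i : Fin n) (f g : CoordRing n) :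
    dunklForm n c f (res n (X i) * g) = dunklForm n c (dunklBar c i f) g := by
  induction f using CoordRing.induction generalizing i g with
  | hC a =>
    rw [dunklForm_algebraMap_left, evalZero_X_mul, mul_zero, Algebra.algebraMap_eq_smul_one,
      map_smul, dunklBar_one, smul_zero, map_zero, LinearMap.zero_apply]
  | hadd p q hp hq => simp only [map_add, LinearMap.add_apply, hp, hq]
  | hX k p hp =>
    rw [dunklForm_X_mul_left, dunklBar_X_mul, map_add, hp, dunklBar_X_mul, map_add,
      LinearMap.add_apply, dunklForm_X_mul_left, dunklForm_bracketBar, bracketBar_comm]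

theorem dunklForm_comm (c : ℂ) (f g : CoordRing n) : dunklForm n c f g = dunklForm n c g f := by
  induction f using CoordRing.induction generalizing g with
  | hC a =>
    induction g using CoordRing.induction with
    | hC b =>
      rw [dunklForm_algebraMap_left, dunklForm_algebraMap_left, AlgHom.commutes, AlgHom.commutes]
      exact mul_comm a b
    | hadd p q hp hq => simp only [map_add, LinearMap.add_apply, hp, hq]
    | hX k p hp =>
      rw [dunklForm_X_mul_left, dunklForm_X_mul_right, Algebra.algebraMap_eq_smul_one,
        map_smul, dunklBar_one, smul_zero, map_zero, map_zero, LinearMap.zero_apply]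
  | hadd p q hp hq => simp only [map_add, LinearMap.add_apply, hp, hq]
  | hX k p hp => rw [dunklForm_X_mul_left, dunklForm_X_mul_right, hp]

/-! ### Degrees and real structure -/

/-- Complex conjugation of the coefficients. -/
abbrev coeffConj : Poly n →+* Poly n := MvPolynomial.map (starRingEnd ℂ)

theorem coeffConj_smul (a : ℂ) (f : Poly n) :
    coeffConj (a • f) = (starRingEnd ℂ a) • coeffConj f := by
  rw [smul_eq_C_mul, map_mul, map_C, ← smul_eq_C_mul]

theorem coeffConj_real_smul (r : ℝ) (f : Poly n) : coeffConj (r • f) = r • coeffConj f := by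
  have h : ∀ g : Poly n, r • g = (r : ℂ) • g := fun g => by
    ext; simp
  rw [h, h, coeffConj_smul, Complex.conj_ofReal]

/-- Homogeneous polynomials of degree `d` with real coefficients. -/
def realHomog (n d : ℕ) : Submodule ℝ (Poly n) where
  carrier := {f | f.IsHomogeneous d ∧ coeffConj f = f}
  add_mem' := fun ⟨h1, h2⟩ ⟨h3, h4⟩ => ⟨h1.add h3, by rw [map_add, h2, h4]⟩
  zero_mem' := ⟨isHomogeneous_zero _ _ _, map_zero _⟩
  smul_mem' r f := fun ⟨h1, h2⟩ => ⟨by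
    have h : r • f = C (r : ℂ) * f := by ext; simp
    rw [h]; exact h1.C_mul _, by rw [coeffConj_real_smul, h2]⟩

theorem ofReal_smul_mem_realHomog {d : ℕ} {f : Poly n} (r : ℝ) (hf : f ∈ realHomog n d) :
    (r : ℂ) • f ∈ realHomog n d := by
  have h : (r : ℂ) • f = r • f := by ext; simp
  rw [h]
  exact Submodule.smul_mem _ _ hf

theorem coeffConj_divDiff (i j : Fin n) (f : Poly n) :
    coeffConj (divDiff i j f) = divDiff i j (coeffConj f) := by
  rcases eq_or_ne i j with rfl | h
  · rw [divDiff_self, divDiff_self, map_zero]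
  · apply mul_left_cancel₀ (X_sub_X_ne_zero h)
    rw [divDiff_spec h]
    have h1 := congrArg coeffConj (divDiff_spec h f)
    rw [map_mul, map_sub, map_X, map_X, map_sub, refl, map_rename] at h1
    exact h1

theorem coeffConj_pderiv (i : Fin n) (f : Poly n) :
    coeffConj (pderiv i f) = pderiv i (coeffConj f) := (pderiv_map).symm

theorem coeffConj_dunkl (c : ℝ) (i : Fin n) (f : Poly n) :
    coeffConj (dunkl c i f) = dunkl c i (coeffConj f) := by
  rw [dunkl_apply', dunkl_apply', map_sub, coeffConj_smul, map_sum, Complex.conj_ofReal,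
    coeffConj_pderiv]
  simp only [coeffConj_divDiff]

theorem homogeneousComponent_X_sub_X_mul (i j : Fin n) (e : ℕ) (g : Poly n) :
    homogeneousComponent (e + 1) ((X i - X j) * g) = (X i - X j) * homogeneousComponent e g := by
  have hX : (X i - X j : Poly n).IsHomogeneous 1 := (isHomogeneous_X _ _).sub (isHomogeneous_X _ _)
  have hm : ∀ a, (X i - X j : Poly n) * homogeneousComponent a g
      ∈ homogeneousSubmodule (Fin n) ℂ (a + 1) := fun a => by
    rw [add_comm]
    exact hX.mul (homogeneousComponent_isHomogeneous a g)
  conv_lhs => rw [← sum_homogeneousComponent g, Finset.mul_sum, map_sum]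
  simp only [homogeneousComponent_of_mem (hm _)]
  rcases le_or_gt (g.totalDegree + 1) e with h | h
  · rw [homogeneousComponent_eq_zero e g (by omega), mul_zero]
    refine Finset.sum_eq_zero fun a ha => if_neg ?_
    rw [Finset.mem_range] at ha
    omega
  · rw [Finset.sum_eq_single e]
    · simp
    · intro a _ ha
      exact if_neg (by omega)
    · intro he
      exact absurd (Finset.mem_range.mpr h) he

theorem isHomogeneous_of_homogeneousComponent_eq_zero {d : ℕ} {g : Poly n}
    (h : ∀ e, e ≠ d → homogeneousComponent e g = 0) : g.IsHomogeneous d := by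
  rw [← sum_homogeneousComponent g]
  refine IsHomogeneous.sum _ _ _ fun e _ => ?_
  rcases eq_or_ne e d with rfl | he
  · exact homogeneousComponent_isHomogeneous _ _
  · rw [h e he]
    exact isHomogeneous_zero _ _ _

/-- Compare homogeneous components in `(xᵢ - xⱼ)g = f - s f` and cancel the linear factor. For `d =
0` the truncated `d - 1` is harmless, since then every component of `g` vanishes. -/
theorem isHomogeneous_divDiff (i j : Fin n) {d : ℕ} {f : Poly n} (hf : f.IsHomogeneous d) :
    (divDiff i j f).IsHomogeneous (d - 1) := by
  rcases eq_or_ne i j with rfl | h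
  · rw [divDiff_self]
    exact isHomogeneous_zero _ _ _
  · refine isHomogeneous_of_homogeneousComponent_eq_zero fun e he => ?_
    apply mul_left_cancel₀ (X_sub_X_ne_zero h)
    rw [← homogeneousComponent_X_sub_X_mul, divDiff_spec h, mul_zero]
    have hm : f - refl i j f ∈ homogeneousSubmodule (Fin n) ℂ d :=
      hf.sub hf.rename_isHomogeneous
    rw [homogeneousComponent_of_mem hm]
    split_ifs with hd
    · omega
    · rfl

theorem isHomogeneous_dunkl (c : ℂ) (i : Fin n) {d : ℕ} {f : Poly n} (hf : f.IsHomogeneous d) :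
    (dunkl c i f).IsHomogeneous (d - 1) := by
  rw [dunkl_apply', smul_eq_C_mul]
  exact hf.pderiv.sub ((IsHomogeneous.sum _ _ _ fun j _ => isHomogeneous_divDiff i j hf).C_mul _)

theorem dunkl_mem_realHomog (c : ℝ) (i : Fin n) {d : ℕ} {f : Poly n} (hf : f ∈ realHomog n d) :
    dunkl c i f ∈ realHomog n (d - 1) :=
  ⟨isHomogeneous_dunkl c i hf.1, by rw [coeffConj_dunkl, hf.2]⟩

/-- Restrictions to `𝔥` of real homogeneous polynomials. -/
def realRes (n d : ℕ) : Submodule ℝ (CoordRing n) :=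
  (realHomog n d).map ((res n).toLinearMap.restrictScalars ℝ)

theorem dunklBar_mem_realRes (c : ℝ) (i : Fin n) {d : ℕ} {f : CoordRing n}
    (hf : f ∈ realRes n d) : dunklBar c i f ∈ realRes n (d - 1) := by
  obtain ⟨g, hg, rfl⟩ := hf
  refine ⟨_, Submodule.sub_mem _ (dunkl_mem_realHomog c i hg) (ofReal_smul_mem_realHomog (n : ℝ)⁻¹
    (Submodule.sum_mem _ (t := Finset.univ) fun j _ => dunkl_mem_realHomog c j hg)), ?_⟩
  simp only [LinearMap.restrictScalars_apply, AlgHom.toLinearMap_apply]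
  rw [dunklBar_res]
  simp

theorem eq_C_of_isHomogeneous_zero {f : Poly n} (hf : f.IsHomogeneous 0) :
    f = C (constantCoeff f) := by
  exact totalDegree_eq_zero_iff_eq_C.mp (totalDegree_zero_iff_isHomogeneous (p := f).2 hf)

theorem dunklBar_eq_zero (c : ℂ) (i : Fin n) {f : Poly n} (hf : f.IsHomogeneous 0) :
    dunklBar c i (res n f) = 0 := by
  rw [eq_C_of_isHomogeneous_zero hf, ← mul_one (C _), ← smul_eq_C_mul, map_smul, map_smul, map_one,
    dunklBar_one, smul_zero]

theorem eq_sum_X_mul_pderiv {k : ℕ} {q : Poly n} (hq : q.IsHomogeneous (k + 1)) :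
    q = ((k + 1 : ℝ)⁻¹ : ℝ) • ∑ i, X i * pderiv i q := by
  rw [hq.sum_X_mul_pderiv, ← Nat.cast_smul_eq_nsmul ℝ, smul_smul]
  push_cast
  rw [inv_mul_cancel₀ (by positivity), one_smul]

theorem pderiv_mem_realHomog (i : Fin n) {d : ℕ} {f : Poly n} (hf : f ∈ realHomog n d) :
    pderiv i f ∈ realHomog n (d - 1) :=
  ⟨hf.1.pderiv, by rw [coeffConj_pderiv, hf.2]⟩

theorem fourierPoly_X_mul (c : ℂ) (i : Fin n) (q : Poly n) (f : CoordRing n) :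
    fourierPoly n c (X i * q) f = dunklBar c i (fourierPoly n c q f) := by
  rw [map_mul, Module.End.mul_apply, fourierPoly_X]

theorem fourierPoly_C (c a : ℂ) (f : CoordRing n) : fourierPoly n c (C a) f = a • f := by
  rw [← algebraMap_eq, AlgHom.commutes, Module.algebraMap_end_apply]

theorem real_smul_eq (r : ℝ) (f : CoordRing n) : r • f = (r : ℂ) • f := by
  obtain ⟨f, rfl⟩ := res_surjective n f
  have h : (r : ℂ) • f = r • f := by ext; simp
  rw [← map_smul (res n) (r : ℂ) f, h]
  rfl

/-- Induction on `k`, peeling off one variable by Euler's formula `(k+1) q = ∑ xᵢ ∂ᵢq`. The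
vanishing clause is separate because `d - k` truncates at zero. -/
theorem fourierPoly_mem_realRes (c : ℝ) {k d : ℕ} {q : Poly n} (hq : q ∈ realHomog n k)
    {f : CoordRing n} (hf : f ∈ realRes n d) :
    fourierPoly n c q f ∈ realRes n (d - k) ∧ (d < k → fourierPoly n c q f = 0) := by
  induction k generalizing q with
  | zero =>
    rw [eq_C_of_isHomogeneous_zero hq.1, fourierPoly_C]
    have h := hq.2
    rw [eq_C_of_isHomogeneous_zero hq.1, map_C] at h
    have h1 := C_injective _ _ h
    rw [Complex.conj_eq_iff_real] at h1
    obtain ⟨r, hr⟩ := h1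
    rw [hr, ← real_smul_eq]
    exact ⟨Submodule.smul_mem _ _ hf, fun h => absurd h (Nat.not_lt_zero _)⟩
  | succ k ih =>
    have h : fourierPoly n c q f
        = ((k + 1 : ℝ)⁻¹ : ℝ) • ∑ i, dunklBar c i (fourierPoly n c (pderiv i q) f) := by
      have h1 : q = (((k + 1 : ℝ)⁻¹ : ℝ) : ℂ) • ∑ i, X i * pderiv i q := by
        conv_lhs => rw [eq_sum_X_mul_pderiv hq.1]
        ext; simp
      conv_lhs => rw [h1]
      rw [map_smul, map_sum, LinearMap.smul_apply, LinearMap.sum_apply, real_smul_eq]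
      simp only [fourierPoly_X_mul]
    have hi := fun i => ih (pderiv_mem_realHomog i hq)
    rw [h]
    constructor
    · refine Submodule.smul_mem _ _ (Submodule.sum_mem _ fun i _ => ?_)
      rw [← Nat.sub_sub]
      exact dunklBar_mem_realRes c i (hi i).1
    · intro hd
      rw [Finset.sum_eq_zero, smul_zero]
      intro i _
      rcases Nat.lt_or_ge d k with h2 | h2
      · rw [(hi i).2 h2, map_zero]
      · obtain ⟨g, hg, hg'⟩ := (hi i).1
        rw [← hg']
        refine dunklBar_eq_zero _ i ?_
        -- Here `k ≤ d < k + 1`: the previous operator has already reached the constants, which the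
        -- next `Yᵢ` kills.
        have : d - k = 0 := by omega
        rw [← this]
        exact hg.1

theorem exists_real_imag {k : ℕ} {q : Poly n} (hq : q.IsHomogeneous k) :
    ∃ q₁ ∈ realHomog n k, ∃ q₂ ∈ realHomog n k, q = q₁ + Complex.I • q₂ := by
  have hc : (coeffConj q).IsHomogeneous k := hq.map _
  have h2 : starRingEnd ℂ 2 = 2 := Complex.conj_ofNat 2
  have hcc : coeffConj (coeffConj q) = q := by
    ext
    simp [coeff_map]
  refine ⟨(1 / 2 : ℂ) • (q + coeffConj q), ⟨?_, ?_⟩, (-Complex.I / 2 : ℂ) • (q - coeffConj q),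
    ⟨?_, ?_⟩, ?_⟩
  · rw [smul_eq_C_mul]
    exact (hq.add hc).C_mul _
  · rw [coeffConj_smul, map_add, hcc, add_comm]
    simp [h2]
  · rw [smul_eq_C_mul]
    exact (hq.sub hc).C_mul _
  · rw [coeffConj_smul, map_sub, hcc, ← neg_sub, smul_neg, ← neg_smul]
    simp [neg_div, h2]
  · rw [smul_smul]
    have : Complex.I * (-Complex.I / 2) = 1 / 2 := by
      rw [mul_div_assoc', mul_neg, Complex.I_mul_I, neg_neg]
    rw [this, ← smul_add, add_add_sub_cancel, ← two_smul ℂ, smul_smul]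
    norm_num

/-- Real and imaginary parts of `q` are treated separately; `f` stays real, which suffices for `f =
δ`. -/
theorem exists_fourierPoly_eq_res (c : ℝ) {k d : ℕ} {q : Poly n} (hq : q.IsHomogeneous k)
    {f : CoordRing n} (hf : f ∈ realRes n d) :
    (∃ g : Poly n, g.IsHomogeneous (d - k) ∧ fourierPoly n c q f = res n g) ∧
      (d < k → fourierPoly n c q f = 0) := by
  obtain ⟨q₁, h₁, q₂, h₂, rfl⟩ := exists_real_imag hq
  obtain ⟨⟨g₁, hg₁, e₁⟩, z₁⟩ := fourierPoly_mem_realRes c h₁ hf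
  obtain ⟨⟨g₂, hg₂, e₂⟩, z₂⟩ := fourierPoly_mem_realRes c h₂ hf
  have h : fourierPoly n c (q₁ + Complex.I • q₂) f
      = fourierPoly n c q₁ f + Complex.I • fourierPoly n c q₂ f := by
    rw [map_add, map_smul, LinearMap.add_apply, LinearMap.smul_apply]
  rw [h]
  constructor
  · refine ⟨g₁ + Complex.I • g₂, hg₁.1.add ?_, ?_⟩
    · rw [smul_eq_C_mul]
      exact hg₂.1.C_mul _
    · rw [map_add, map_smul, ← e₁, ← e₂]
      rfl
  · intro hd
    rw [z₁ hd, z₂ hd, smul_zero, add_zero]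

/-! ### Antisymmetric polynomials -/

/-- The sign character of `Sₙ`, with complex values. -/
def sgn (w : Equiv.Perm (Fin n)) : ℂ := ((Equiv.Perm.sign w : ℤ) : ℂ)

theorem sgn_mul (v w : Equiv.Perm (Fin n)) : sgn (v * w) = sgn v * sgn w := by
  simp [sgn]

theorem sgn_mul_self (w : Equiv.Perm (Fin n)) : sgn w * sgn w = 1 := by
  rw [← sgn_mul]
  simp [sgn]

theorem sgn_one : sgn (1 : Equiv.Perm (Fin n)) = 1 := by simp [sgn]

theorem sgn_swap {i j : Fin n} (h : i ≠ j) : sgn (Equiv.swap i j) = -1 := by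
  simp [sgn, Equiv.Perm.sign_swap h]

/-- Antisymmetrization. -/
def alt : Poly n →ₗ[ℂ] Poly n := ∑ w : Equiv.Perm (Fin n), sgn w • (rename w).toLinearMap

theorem alt_apply (f : Poly n) : alt f = ∑ w : Equiv.Perm (Fin n), sgn w • rename w f := by
  simp [alt]

theorem rename_alt (v : Equiv.Perm (Fin n)) (f : Poly n) : rename v (alt f) = sgn v • alt f := by
  rw [alt_apply, map_sum, Finset.smul_sum]
  refine Fintype.sum_equiv (Equiv.mulLeft v) _ _ fun w => ?_
  rw [map_smul, rename_rename, Equiv.coe_mulLeft, sgn_mul, smul_smul, ← mul_assoc, sgn_mul_self,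
    one_mul]
  rfl

theorem isHomogeneous_alt {d : ℕ} {f : Poly n} (hf : f.IsHomogeneous d) :
    (alt f).IsHomogeneous d := by
  rw [alt_apply]
  refine IsHomogeneous.sum _ _ _ fun w _ => ?_
  rw [smul_eq_C_mul]
  exact hf.rename_isHomogeneous.C_mul _

/-- The degree `n (n - 1) / 2` of the Vandermonde determinant. -/
def vandDeg (n : ℕ) : ℕ := ∑ i : Fin n, (i : ℕ)

theorem sum_range_card_le_sum (s : Finset ℕ) : ∑ i ∈ Finset.range s.card, i ≤ ∑ i ∈ s, i := by
  induction s using Finset.induction_on_max with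
  | empty => simp
  | insert a s ha ih =>
    have hn : a ∉ s := fun h => lt_irrefl _ (ha a h)
    rw [Finset.card_insert_of_notMem hn, Finset.sum_range_succ, Finset.sum_insert hn, add_comm]
    have : s.card ≤ a := by
      have h : s ⊆ Finset.range a := fun x hx => Finset.mem_range.mpr (ha x hx)
      simpa using Finset.card_le_card h
    exact Nat.add_le_add this ih

theorem vandDeg_le_sum {a : Fin n → ℕ} (ha : Function.Injective a) : vandDeg n ≤ ∑ i, a i := by
  have h := sum_range_card_le_sum (Finset.univ.image a)
  rw [Finset.card_image_of_injective _ ha, Finset.sum_image (fun x _ y _ e => ha e),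
    Finset.card_univ, Fintype.card_fin, Finset.sum_range] at h
  exact h

/-- A transposition of two equal exponents fixes the monomial and negates its coefficient. So
surviving monomials have distinct exponents, hence degree at least `0 + 1 + ⋯ + (n-1)`. -/
theorem eq_zero_of_antisymm {d : ℕ} (hd : d < vandDeg n) {f : Poly n} (hf : f.IsHomogeneous d)
    (h : ∀ w : Equiv.Perm (Fin n), rename w f = sgn w • f) : f = 0 := by
  ext a
  rw [coeff_zero]
  by_contra ha
  have hdeg : ∑ i, a i = d := by
    rw [hf.degree_eq_sum_deg_support (mem_support_iff.mpr ha)]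
    exact (Finset.sum_subset (Finset.subset_univ _) fun i _ hi => Finsupp.notMem_support_iff.mp hi).symm
  have hinj : ¬ Function.Injective a := fun hi => by
    have := vandDeg_le_sum hi
    omega
  obtain ⟨i, j, hij, hne⟩ := Function.not_injective_iff.mp hinj
  have h1 := congrArg (coeff a) (h (Equiv.swap i j))
  have h2 : Finsupp.mapDomain (Equiv.swap i j) a = a := by
    ext k
    rw [Finsupp.mapDomain_equiv_apply, Equiv.symm_swap]
    rcases eq_or_ne k i with rfl | hi
    · rw [Equiv.swap_apply_left, hij]
    · rcases eq_or_ne k j with rfl | hj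
      · rw [Equiv.swap_apply_right, hij]
      · rw [Equiv.swap_apply_of_ne_of_ne hi hj]
  have h3 := coeff_rename_mapDomain _ (Equiv.swap i j).injective f a
  rw [h2] at h3
  rw [h3, sgn_swap hne, coeff_smul, neg_one_smul] at h1
  exact ha (self_eq_neg.mp h1)

/-- The Vandermonde determinant in `ℂ[x₁, …, xₙ]`. -/
def vander (n : ℕ) : Poly n := ∏ i : Fin n, ∏ j ∈ Finset.Ioi i, (X i - X j)

theorem res_vander : res n (vander n) = vandermonde n := by
  rw [vander, vandermonde, map_prod]
  simp only [map_prod]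

theorem vander_eq : vander n = ∏ j : Fin n, ∏ i ∈ Finset.Iio j, (X i - X j) := by
  rw [vander]
  refine Finset.prod_comm' fun i j => ?_
  simp

theorem vander_isHomogeneous : (vander n).IsHomogeneous (vandDeg n) := by
  rw [vander_eq, vandDeg]
  refine IsHomogeneous.prod _ _ _ fun j _ => ?_
  have h := IsHomogeneous.prod (Finset.Iio j) (fun i => (X i - X j : Poly n)) (fun _ => 1)
    fun i _ => (isHomogeneous_X _ _).sub (isHomogeneous_X _ _)
  simpa using h

theorem vander_mem_realHomog : vander n ∈ realHomog n (vandDeg n) :=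
  ⟨vander_isHomogeneous, by simp [vander, map_prod]⟩

theorem vander_eq_det : vander n
    = (∏ i : Fin n, ∏ _j ∈ Finset.Ioi i, (-1)) * (Matrix.vandermonde (X : Fin n → Poly n)).det := by
  rw [vander, Matrix.det_vandermonde, ← Finset.prod_mul_distrib]
  refine Finset.prod_congr rfl fun i _ => ?_
  rw [← Finset.prod_mul_distrib]
  refine Finset.prod_congr rfl fun j _ => ?_
  ring

theorem rename_vander (w : Equiv.Perm (Fin n)) : rename w (vander n) = sgn w • vander n := by
  rw [vander_eq_det, map_mul, map_prod]
  have h1 : rename w (Matrix.vandermonde (X : Fin n → Poly n)).det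
      = ((Matrix.vandermonde (X : Fin n → Poly n)).submatrix w id).det := by
    rw [AlgHom.map_det]
    congr 1
    ext i j : 2
    simp [Matrix.vandermonde_apply]
  rw [h1, Matrix.det_permute]
  simp only [map_prod, map_neg, map_one]
  rw [smul_eq_C_mul, sgn, mul_left_comm]
  simp

theorem permAct_vandermonde (w : Equiv.Perm (Fin n)) :
    permAct w (vandermonde n) = sgn w • vandermonde n := by
  rw [← res_vander, permAct_res, rename_vander, map_smul]

theorem vandermonde_mem_realRes : vandermonde n ∈ realRes n (vandDeg n) :=
  ⟨vander n, vander_mem_realHomog, res_vander⟩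

theorem vander_ne_zero : vander n ≠ 0 := by
  rw [vander]
  refine Finset.prod_ne_zero_iff.mpr fun i _ => Finset.prod_ne_zero_iff.mpr fun j hj => ?_
  exact X_sub_X_ne_zero (Finset.mem_Ioi.mp hj).ne

theorem vandermonde_ne_zero : vandermonde n ≠ 0 := by
  rw [← res_vander]
  intro h
  rw [Ideal.Quotient.mkₐ_eq_mk, Ideal.Quotient.eq_zero_iff_mem, traceIdeal,
    Ideal.mem_span_singleton] at h
  obtain ⟨g, hg⟩ := h
  -- A point of `𝔥` with pairwise distinct coordinates, where no factor of `δ` vanishes.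
  have e := congrArg (MvPolynomial.eval fun i : Fin n => (i : ℂ) - ((n : ℂ) - 1) / 2) hg
  have h0 : ∑ i : Fin n, ((i : ℂ) - ((n : ℂ) - 1) / 2) = 0 := by
    rw [Finset.sum_sub_distrib, Finset.sum_const, Finset.card_univ, Fintype.card_fin,
      nsmul_eq_mul]
    have h1 : (∑ i : Fin n, (i : ℂ)) * 2 = (n : ℂ) * ((n : ℂ) - 1) := by
      have h2 := Finset.sum_range_id_mul_two n
      rw [Finset.sum_range] at h2
      rcases Nat.eq_zero_or_pos n with rfl | hp
      · simp
      · have h3 := congrArg (Nat.cast : ℕ → ℂ) h2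
        push_cast [Nat.cast_sub (Nat.succ_le_of_lt hp)] at h3
        simpa using h3
    linear_combination h1 / 2
  rw [map_mul, map_sum] at e
  simp only [eval_X, h0, zero_mul] at e
  rw [vander, map_prod, Finset.prod_eq_zero_iff] at e
  obtain ⟨i, _, e⟩ := e
  rw [map_prod, Finset.prod_eq_zero_iff] at e
  obtain ⟨j, hj, e⟩ := e
  rw [map_sub, eval_X, eval_X, sub_sub_sub_cancel_right, sub_eq_zero] at e
  have h2 : (i : ℕ) = j := by exact_mod_cast e
  exact (Finset.mem_Ioi.mp hj).ne (Fin.ext h2)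

/-! ### Invariant polynomials annihilate the Vandermonde determinant -/

theorem permAct_fourierPoly_vandermonde (c : ℂ) (w : Equiv.Perm (Fin n)) (q : Poly n) :
    permAct w (fourierPoly n c q (vandermonde n))
      = sgn w • fourierPoly n c (rename w q) (vandermonde n) := by
  rw [← fourier_res, permAct_fourier, permAct_vandermonde, map_smul, permAct_res, fourier_res]

/-- The vector `Φ(p)δ` is antisymmetric of degree below `N`. Its lift `g` need not be antisymmetric,
so `alt g` is used: it is zero, yet restricts to `n!` times `Φ(p)δ`. -/
theorem fourierPoly_vandermonde_eq_zero_of_pos (c : ℝ) {k : ℕ} (hk : 0 < k) {p : Poly n}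
    (hp : p.IsHomogeneous k) (hs : ∀ w : Equiv.Perm (Fin n), rename w p = p) :
    fourierPoly n c p (vandermonde n) = 0 := by
  obtain ⟨⟨g, hg, e⟩, hz⟩ := exists_fourierPoly_eq_res c hp (vandermonde_mem_realRes (n := n))
  rcases Nat.lt_or_ge (vandDeg n) k with h | h
  · exact hz h
  · have h0 : alt g = 0 := eq_zero_of_antisymm (by omega) (isHomogeneous_alt hg)
      fun w => rename_alt w g
    have h1 := congrArg (res n) h0
    rw [alt_apply, map_sum, map_zero] at h1
    have h2 : ∀ w : Equiv.Perm (Fin n), res n (sgn w • rename w g)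
        = fourierPoly n c p (vandermonde n) := fun w => by
      rw [map_smul, ← permAct_res, ← e, permAct_fourierPoly_vandermonde, hs, smul_smul,
        sgn_mul_self, one_smul]
    simp only [h2] at h1
    rw [Finset.sum_const, ← Nat.cast_smul_eq_nsmul ℂ, smul_eq_zero] at h1
    refine h1.resolve_left ?_
    rw [Finset.card_univ]
    exact Nat.cast_ne_zero.mpr Fintype.card_ne_zero

theorem fourierPoly_vandermonde_eq_zero (c : ℝ) {p : Poly n}
    (hs : ∀ w : Equiv.Perm (Fin n), rename w p = p) (h0 : constantCoeff p = 0) :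
    fourierPoly n c p (vandermonde n) = 0 := by
  rw [← sum_homogeneousComponent p, map_sum, LinearMap.sum_apply]
  refine Finset.sum_eq_zero fun k _ => ?_
  rcases Nat.eq_zero_or_pos k with rfl | hk
  · rw [homogeneousComponent_zero, ← constantCoeff_eq, h0, C_0, map_zero, LinearMap.zero_apply]
  · refine fourierPoly_vandermonde_eq_zero_of_pos c hk (homogeneousComponent_isHomogeneous _ _)
      fun w => ?_
    rw [rename_homogeneousComponent, hs]

theorem exists_symm_lift {f : CoordRing n} (hf : ∀ w : Equiv.Perm (Fin n), permAct w f = f) :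
    ∃ p : Poly n, (∀ w : Equiv.Perm (Fin n), rename w p = p) ∧ res n p = f := by
  obtain ⟨g, rfl⟩ := res_surjective n f
  refine ⟨(Fintype.card (Equiv.Perm (Fin n)) : ℂ)⁻¹ • ∑ w : Equiv.Perm (Fin n), rename w g,
    fun v => ?_, ?_⟩
  · rw [map_smul, map_sum]
    congr 1
    refine Fintype.sum_equiv (Equiv.mulLeft v) _ _ fun w => ?_
    rw [rename_rename, Equiv.coe_mulLeft]
    rfl
  · rw [map_smul, map_sum]
    have h : ∀ w : Equiv.Perm (Fin n), res n (rename w g) = res n g := hf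
    simp only [h]
    rw [Finset.sum_const, Finset.card_univ, ← Nat.cast_smul_eq_nsmul ℂ, smul_smul,
      inv_mul_cancel₀ (Nat.cast_ne_zero.mpr Fintype.card_ne_zero), one_smul]

theorem fourier_vandermonde_eq_zero (c : ℝ) {f : CoordRing n} (hf : f ∈ invariantIdeal n) :
    fourier n c f (vandermonde n) = 0 := by
  refine Submodule.span_induction ?_ ?_ ?_ ?_ hf
  · rintro f ⟨hs, h0⟩
    obtain ⟨p, hp, rfl⟩ := exists_symm_lift hs
    rw [fourier_res]
    rw [evalZero_res] at h0
    exact fourierPoly_vandermonde_eq_zero c hp h0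
  · rw [map_zero, LinearMap.zero_apply]
  · intro f g _ _ hf hg
    rw [map_add, LinearMap.add_apply, hf, hg, add_zero]
  · intro a f _ hf
    rw [smul_eq_mul, fourier_mul_apply, hf, map_zero]

/-! ### Description of the harmonic polynomials -/

theorem dunklSub_self (c : ℂ) (i : Fin n) : dunklSub c i i = 0 := by
  rw [← dunklBar_sub, sub_self]

/-- Telescoping along consecutive indices. -/
theorem dunklSub_mem (c : ℂ) (i j : Fin n) : dunklSub c i j ∈ dunklAlgebra n c := by
  have up : ∀ (d : ℕ) (i j : Fin n), (i : ℕ) + d = j → dunklSub c i j ∈ dunklAlgebra n c := by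
    intro d
    induction d with
    | zero =>
      intro i j h
      have : i = j := Fin.ext h
      rw [this, dunklSub_self]
      exact zero_mem _
    | succ d ih =>
      intro i j h
      have hl : (i : ℕ) + d < n := by have := j.2; omega
      have e : dunklSub c i j = dunklSub c i ⟨i + d, hl⟩ + dunklSub c ⟨i + d, hl⟩ j := by
        simp only [← dunklBar_sub]
        abel
      rw [e]
      refine add_mem (ih _ _ rfl) (Algebra.subset_adjoin ⟨_, _, ?_, rfl⟩)
      simpa [add_assoc] using h
  rcases le_total (i : ℕ) j with h | h
  · exact up (j - i) i j (by omega)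
  · have e : dunklSub c i j = - dunklSub c j i := by
      simp only [← dunklBar_sub]
      abel
    rw [e]
    exact neg_mem (up (i - j) j i (by omega))

theorem fourier_mem (c : ℂ) (f : CoordRing n) : fourier n c f ∈ dunklAlgebra n c := by
  induction f using CoordRing.induction with
  | hC a => rw [AlgHom.commutes]; exact Subalgebra.algebraMap_mem _ _
  | hadd p q hp hq => rw [map_add]; exact add_mem hp hq
  | hX k p hp =>
    rw [map_mul, fourier_X]
    exact mul_mem (Subalgebra.smul_mem _ (sum_mem fun j _ => dunklSub_mem c k j) _) hp

theorem mem_harmonic_iff (c : ℂ) (h : CoordRing n) :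
    h ∈ harmonic n c ↔ ∃ f, fourier n c f (vandermonde n) = h := by
  rw [mem_harmonic]
  constructor
  · rintro ⟨D, hD, rfl⟩
    have hle : dunklAlgebra n c ≤ (fourier n c).range := by
      refine Algebra.adjoin_le ?_
      rintro _ ⟨i, j, _, rfl⟩
      exact ⟨_, fourier_sub c i j⟩
    obtain ⟨f, rfl⟩ := hle hD
    exact ⟨f, rfl⟩
  · rintro ⟨f, rfl⟩
    exact ⟨_, fourier_mem c f, rfl⟩

theorem dunklForm_eq_zero_of_mem (c : ℝ) {f h : CoordRing n} (hf : f ∈ invariantIdeal n)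
    (hh : h ∈ harmonic n c) : dunklForm n c f h = 0 := by
  obtain ⟨g, rfl⟩ := (mem_harmonic_iff _ _).mp hh
  rw [← dunklForm_mul_left, mul_comm, dunklForm_mul_left, fourier_vandermonde_eq_zero c hf, map_zero]

/-! ### A lower bound for the class sum of transpositions in a given degree -/

section Words

variable {K : ℕ}

/-- Exchanging the letter in position `j` of a word with an extra letter. -/
def exchange (j : Fin n) : (Fin n → Fin K) × Fin K ≃ (Fin n → Fin K) × Fin K where
  toFun p := (Function.update p.1 j p.2, p.1 j)
  invFun p := (Function.update p.1 j p.2, p.1 j)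
  left_inv p := by simp
  right_inv p := by simp

theorem update_update_eq_comp_swap {j k : Fin n} (h : k ≠ j) (u : Fin n → Fin K) :
    Function.update (Function.update u j (u k)) k (u j) = u ∘ Equiv.swap j k := by
  funext l
  rw [Function.comp_apply]
  rcases eq_or_ne l k with rfl | hk
  · rw [Function.update_self, Equiv.swap_apply_right]
  · rw [Function.update_of_ne hk]
    rcases eq_or_ne l j with rfl | hj
    · rw [Function.update_self, Equiv.swap_apply_left]
    · rw [Function.update_of_ne hj, Equiv.swap_apply_of_ne_of_ne hj hk]

/-- Reindex by exchanging letter `j` with the extra letter `b`. For `k = j` the free letter runs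
over those below `u j`, of which there are `u j`; otherwise it is forced to be `u k`. -/
theorem sum_lt_comp_swap (v : (Fin n → Fin K) → ℝ) (j k : Fin n) :
    ∑ u : Fin n → Fin K, ∑ b : Fin K, (if u j < b ∧ u k = u j then
        v (Function.update u j b) * v (Function.update u k b) else 0)
      = if k = j then ∑ u, ((u j : ℕ) : ℝ) * v u ^ 2
        else ∑ u, if u k < u j then v u * v (u ∘ Equiv.swap j k) else 0 := by
  rw [← Fintype.sum_prod_type', ← (exchange j).sum_comp, Fintype.sum_prod_type]
  split_ifs with h
  · subst h
    refine Finset.sum_congr rfl fun u _ => ?_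
    simp only [exchange, Equiv.coe_fn_mk, Function.update_self, and_true, Function.update_idem,
      Function.update_eq_self]
    rw [← Finset.sum_filter, Finset.sum_const, nsmul_eq_mul, pow_two]
    congr 2
    have : (Finset.univ.filter fun x : Fin K => x < u k) = Finset.Iio (u k) := by
      ext; simp
    rw [this, Fin.card_Iio]
  · refine Finset.sum_congr rfl fun u _ => ?_
    simp only [exchange, Equiv.coe_fn_mk, Function.update_self, Function.update_idem,
      Function.update_eq_self, Function.update_of_ne h]
    rw [Finset.sum_eq_single (u k)]
    · simp only [and_true, update_update_eq_comp_swap h]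
    · intro b _ hb
      exact if_neg fun h' => hb h'.2.symm
    · simp

/-- Take the squared norms, summed over `a < b`, of the operators that replace one letter at a time,
as with the root vectors of `𝔤𝔩_K` in Schur–Weyl duality. Expanding, diagonal terms give the letter
sum of a word and off-diagonal terms give half of the transpositions with `u k ≠ u j`. The remaining
transpositions fix the word and contribute squares. -/
theorem sum_comp_swap_nonneg (v : (Fin n → Fin K) → ℝ) :
    0 ≤ ∑ j, ∑ k, (if k = j then 0 else ∑ u, v u * v (u ∘ Equiv.swap j k))
      + 2 * ∑ u, (∑ j, ((u j : ℕ) : ℝ)) * v u ^ 2 := by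
  have hQ : 0 ≤ ∑ u : Fin n → Fin K, ∑ a : Fin K, ∑ b : Fin K, if a < b then
      (∑ j, if u j = a then v (Function.update u j b) else 0) ^ 2 else 0 := by
    refine Finset.sum_nonneg fun u _ => Finset.sum_nonneg fun a _ => Finset.sum_nonneg fun b _ => ?_
    split_ifs
    · positivity
    · exact le_rfl
  have e1 : (∑ u : Fin n → Fin K, ∑ a : Fin K, ∑ b : Fin K, if a < b then
      (∑ j, if u j = a then v (Function.update u j b) else 0) ^ 2 else 0)
      = ∑ j, ∑ k, ∑ u : Fin n → Fin K, ∑ b : Fin K, (if u j < b ∧ u k = u j then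
        v (Function.update u j b) * v (Function.update u k b) else 0) := by
    have h : ∀ u : Fin n → Fin K, (∑ a : Fin K, ∑ b : Fin K, if a < b then
        (∑ j, if u j = a then v (Function.update u j b) else 0) ^ 2 else 0)
        = ∑ j, ∑ k, ∑ b : Fin K, (if u j < b ∧ u k = u j then
          v (Function.update u j b) * v (Function.update u k b) else 0) := by
      intro u
      have h1 : ∀ a b : Fin K, (if a < b then
          (∑ j, if u j = a then v (Function.update u j b) else 0) ^ 2 else 0)
          = ∑ j, ∑ k, if u j = a then (if a < b ∧ u k = a then
            v (Function.update u j b) * v (Function.update u k b) else 0) else 0 := by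
        intro a b
        by_cases hab : a < b
        · rw [if_pos hab, pow_two, Finset.sum_mul_sum]
          refine Finset.sum_congr rfl fun j _ => Finset.sum_congr rfl fun k _ => ?_
          by_cases h2 : u j = a <;> by_cases h3 : u k = a <;> simp [h2, h3, hab]
        · simp [hab]
      simp only [h1]
      have h2 : ∀ a : Fin K, ∑ b : Fin K, ∑ j, ∑ k, (if u j = a then (if a < b ∧ u k = a then
            v (Function.update u j b) * v (Function.update u k b) else 0) else 0)
          = ∑ j, ∑ k, if u j = a then ∑ b : Fin K, (if a < b ∧ u k = a then
            v (Function.update u j b) * v (Function.update u k b) else 0) else 0 := by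
        intro a
        rw [Finset.sum_comm]
        refine Finset.sum_congr rfl fun j _ => ?_
        rw [Finset.sum_comm]
        refine Finset.sum_congr rfl fun k _ => ?_
        split_ifs <;> simp
      simp only [h2]
      rw [Finset.sum_comm]
      refine Finset.sum_congr rfl fun j _ => ?_
      rw [Finset.sum_comm]
      refine Finset.sum_congr rfl fun k _ => ?_
      rw [Finset.sum_ite_eq, if_pos (Finset.mem_univ _)]
    simp only [h]
    rw [Finset.sum_comm]
    refine Finset.sum_congr rfl fun j _ => ?_
    rw [Finset.sum_comm]
  rw [e1] at hQ
  simp only [sum_lt_comp_swap] at hQ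
  set A : Fin n → Fin n → ℝ := fun j k =>
    ∑ u, if u k < u j then v u * v (u ∘ Equiv.swap j k) else 0 with hA
  have hsplit : ∀ j k, (∑ u, v u * v (u ∘ Equiv.swap j k))
      = A j k + A k j + ∑ u, if u k = u j then v u ^ 2 else 0 := by
    intro j k
    simp only [hA]
    rw [← Finset.sum_add_distrib, ← Finset.sum_add_distrib]
    refine Finset.sum_congr rfl fun u _ => ?_
    rw [Equiv.swap_comm k j]
    rcases lt_trichotomy (u k) (u j) with h | h | h
    · simp [h, h.not_gt, h.ne]
    · have : u ∘ Equiv.swap j k = u := by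
        funext l
        rw [Function.comp_apply]
        exact Equiv.apply_swap_eq_self h.symm l
      simp [h, this, pow_two]
    · simp [h, h.not_gt, h.ne']
  have hdiag : ∑ j, ∑ k : Fin n, (if k = j then ∑ u, ((u j : ℕ) : ℝ) * v u ^ 2 else A j k)
      = ∑ j, ∑ k, (if k = j then 0 else A j k) + ∑ u, (∑ j, ((u j : ℕ) : ℝ)) * v u ^ 2 := by
    have : ∑ u, (∑ j, ((u j : ℕ) : ℝ)) * v u ^ 2 = ∑ j, ∑ u, ((u j : ℕ) : ℝ) * v u ^ 2 := by
      rw [Finset.sum_comm]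
      simp only [Finset.sum_mul]
    rw [this, ← Finset.sum_add_distrib]
    refine Finset.sum_congr rfl fun j _ => ?_
    have e : ∀ k : Fin n, (if k = j then ∑ u, ((u j : ℕ) : ℝ) * v u ^ 2 else A j k)
        = (if k = j then 0 else A j k) + if k = j then ∑ u, ((u j : ℕ) : ℝ) * v u ^ 2 else 0 := by
      intro k
      split_ifs <;> simp
    simp only [e]
    rw [Finset.sum_add_distrib, Finset.sum_ite_eq', if_pos (Finset.mem_univ _)]
  rw [hdiag] at hQ
  have hAA : ∑ j, ∑ k, (if k = j then 0 else ∑ u, v u * v (u ∘ Equiv.swap j k))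
      = 2 * ∑ j, ∑ k, (if k = j then 0 else A j k)
        + ∑ j, ∑ k, (if k = j then 0 else ∑ u, if u k = u j then v u ^ 2 else 0) := by
    have h1 : ∑ j, ∑ k, (if k = j then 0 else A k j) = ∑ j, ∑ k, (if k = j then 0 else A j k) := by
      rw [Finset.sum_comm]
      simp only [eq_comm]
    rw [two_mul]
    nth_rw 2 [← h1]
    simp only [← Finset.sum_add_distrib]
    refine Finset.sum_congr rfl fun j _ => Finset.sum_congr rfl fun k _ => ?_
    split_ifs
    · simp
    · rw [hsplit]
  have hpos : 0 ≤ ∑ j, ∑ k, (if k = j then 0 else ∑ u, if u k = u j then v u ^ 2 else 0) := by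
    refine Finset.sum_nonneg fun j _ => Finset.sum_nonneg fun k _ => ?_
    split_ifs
    · exact le_rfl
    · refine Finset.sum_nonneg fun u _ => ?_
      split_ifs
      · positivity
      · exact le_rfl
  rw [hAA]
  linarith

end Words

/-- Exponent vectors of total degree `k`. -/
abbrev DegWord (n k : ℕ) := {u : Fin n → Fin (k + 1) // ∑ j, (u j : ℕ) = k}

/-- The permutation action on exponent vectors. -/
def DegWord.perm {k : ℕ} (w : Equiv.Perm (Fin n)) (u : DegWord n k) : DegWord n k :=
  ⟨u.1 ∘ w, (Equiv.sum_comp w fun j => ((u.1 j : Fin (k + 1)) : ℕ)).trans u.2⟩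

theorem DegWord.perm_swap_swap {k : ℕ} (i j : Fin n) (u : DegWord n k) :
    (u.perm (Equiv.swap i j)).perm (Equiv.swap i j) = u := by
  apply Subtype.ext
  funext l
  simp [DegWord.perm]

/-- The class sum of transpositions (each taken twice) on coefficient vectors. -/
def swapSum (n k : ℕ) : EuclideanSpace ℝ (DegWord n k) →ₗ[ℝ] EuclideanSpace ℝ (DegWord n k) where
  toFun v := WithLp.toLp 2 fun u =>
    ∑ i, ∑ j, if j = i then 0 else v (u.perm (Equiv.swap i j))
  map_add' v v' := by
    ext u
    simp only [PiLp.add_apply, ← Finset.sum_add_distrib]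
    refine Finset.sum_congr rfl fun i _ => Finset.sum_congr rfl fun j _ => ?_
    split_ifs <;> simp
  map_smul' a v := by
    ext u
    simp only [PiLp.smul_apply, smul_eq_mul, Finset.mul_sum, RingHom.id_apply]
    refine Finset.sum_congr rfl fun i _ => Finset.sum_congr rfl fun j _ => ?_
    split_ifs <;> simp

theorem swapSum_apply {k : ℕ} (v : EuclideanSpace ℝ (DegWord n k)) (u : DegWord n k) :
    swapSum n k v u = ∑ i, ∑ j, if j = i then 0 else v (u.perm (Equiv.swap i j)) := rfl

theorem sum_mul_swapSum {k : ℕ} (v v' : EuclideanSpace ℝ (DegWord n k)) :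
    ∑ u, v u * swapSum n k v' u
      = ∑ i, ∑ j, if j = i then 0 else ∑ u, v u * v' (u.perm (Equiv.swap i j)) := by
  simp only [swapSum_apply, Finset.mul_sum]
  rw [Finset.sum_comm]
  refine Finset.sum_congr rfl fun i _ => ?_
  rw [Finset.sum_comm]
  refine Finset.sum_congr rfl fun j _ => ?_
  split_ifs <;> simp

theorem swapSum_isSymmetric (n k : ℕ) : (swapSum n k).IsSymmetric := by
  intro v v'
  have h1 : ∀ x y : EuclideanSpace ℝ (DegWord n k), inner ℝ x y = ∑ u, x u * y u := by
    intro x y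
    simp [PiLp.inner_apply, mul_comm]
  rw [h1, h1, sum_mul_swapSum]
  simp only [mul_comm (swapSum n k v _)]
  rw [sum_mul_swapSum]
  refine Finset.sum_congr rfl fun i _ => Finset.sum_congr rfl fun j _ => ?_
  split_ifs
  · rfl
  · have e : Function.Involutive (DegWord.perm (n := n) (k := k) (Equiv.swap i j)) :=
      DegWord.perm_swap_swap i j
    refine Fintype.sum_equiv e.toPerm _ _ fun u => ?_
    rw [Function.Involutive.coe_toPerm, DegWord.perm_swap_swap, mul_comm]

/-- Extend `v` by zero to all words and apply `sum_comp_swap_nonneg`: on the support the letter sum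
is the degree `k`. -/
theorem neg_two_mul_le_of_swapSum_eq {k : ℕ} {v : EuclideanSpace ℝ (DegWord n k)} (hv : v ≠ 0)
    {a : ℝ} (h : swapSum n k v = a • v) : -(2 * k : ℝ) ≤ a := by
  set v' : (Fin n → Fin (k + 1)) → ℝ := fun u =>
    if hu : ∑ j, (u j : ℕ) = k then v ⟨u, hu⟩ else 0 with hv'
  have hv0 : ∀ u : DegWord n k, v' u.1 = v u := fun u => by
    simp only [hv', dif_pos u.2]
  have hsum : ∀ F : (Fin n → Fin (k + 1)) → ℝ, (∀ u, v' u = 0 → F u = 0) →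
      ∑ u, F u = ∑ u : DegWord n k, F u.1 := by
    intro F hF
    symm
    refine Fintype.sum_of_injective Subtype.val Subtype.val_injective _ _ ?_ fun _ => rfl
    intro u hu
    refine hF u (dif_neg fun h' => hu ⟨⟨u, h'⟩, rfl⟩)
  have key := sum_comp_swap_nonneg v'
  rw [hsum _ fun u hu => by rw [hu]; ring] at key
  have h1 : ∀ j i : Fin n, ∑ u, v' u * v' (u ∘ Equiv.swap j i)
      = ∑ u : DegWord n k, v u * v (u.perm (Equiv.swap j i)) := by
    intro j i
    rw [hsum _ fun u hu => by rw [hu, zero_mul]]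
    refine Finset.sum_congr rfl fun u _ => ?_
    rw [hv0, ← hv0 (u.perm _)]
    rfl
  simp only [h1, hv0] at key
  rw [← sum_mul_swapSum, h] at key
  have h2 : ∀ u : DegWord n k, ∑ j, ((u.1 j : ℕ) : ℝ) = k := fun u => by
    exact_mod_cast u.2
  simp only [h2, PiLp.smul_apply, smul_eq_mul] at key
  have h3 : 0 < ∑ u, v u ^ 2 := by
    have h4 : ∃ u, v u ≠ 0 := by
      by_contra! h4
      exact hv (by ext u; exact h4 u)
    obtain ⟨u, hu⟩ := h4
    exact Finset.sum_pos' (fun _ _ => sq_nonneg _) ⟨u, Finset.mem_univ _, by positivity⟩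
  have h5 : ∑ u, v u * (a * v u) = a * ∑ u, v u ^ 2 := by
    rw [Finset.mul_sum]
    exact Finset.sum_congr rfl fun u _ => by ring
  rw [h5, ← Finset.mul_sum] at key
  by_contra! hlt
  nlinarith

/-- The polynomial with a given vector of real coefficients. -/
def polyOf {k : ℕ} (v : EuclideanSpace ℝ (DegWord n k)) : Poly n :=
  ∑ u : DegWord n k, (v u : ℂ) • ∏ l, X l ^ (u.1 l : ℕ)

theorem polyOf_add {k : ℕ} (v v' : EuclideanSpace ℝ (DegWord n k)) :
    polyOf (v + v') = polyOf v + polyOf v' := by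
  simp [polyOf, add_smul, Finset.sum_add_distrib]

theorem polyOf_zero {k : ℕ} : polyOf (0 : EuclideanSpace ℝ (DegWord n k)) = 0 := by
  simp [polyOf]

theorem polyOf_smul {k : ℕ} (a : ℝ) (v : EuclideanSpace ℝ (DegWord n k)) :
    polyOf (a • v) = (a : ℂ) • polyOf v := by
  simp [polyOf, mul_smul, Finset.smul_sum]

theorem polyOf_sum {k : ℕ} {ι : Type*} (s : Finset ι) (v : ι → EuclideanSpace ℝ (DegWord n k)) :
    polyOf (∑ i ∈ s, v i) = ∑ i ∈ s, polyOf (v i) :=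
  map_sum (⟨⟨polyOf, polyOf_zero⟩, polyOf_add⟩ : EuclideanSpace ℝ (DegWord n k) →+ Poly n) v s

theorem polyOf_mem {k : ℕ} (v : EuclideanSpace ℝ (DegWord n k)) : polyOf v ∈ realHomog n k := by
  refine Submodule.sum_mem _ fun u _ => ofReal_smul_mem_realHomog _ ⟨?_, ?_⟩
  · have h := IsHomogeneous.prod Finset.univ (fun l => (X l ^ (u.1 l : ℕ) : Poly n))
      (fun l => (u.1 l : ℕ)) fun l _ => isHomogeneous_X_pow _ _
    rwa [u.2] at h
  · simp [map_prod]

theorem rename_polyOf {k : ℕ} (i j : Fin n) (v : EuclideanSpace ℝ (DegWord n k)) :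
    refl i j (polyOf v)
      = ∑ u : DegWord n k, (v (u.perm (Equiv.swap i j)) : ℂ) • ∏ l, X l ^ (u.1 l : ℕ) := by
  rw [polyOf, map_sum]
  have e : Function.Involutive (DegWord.perm (n := n) (k := k) (Equiv.swap i j)) :=
    DegWord.perm_swap_swap i j
  refine Fintype.sum_equiv e.toPerm _ _ fun u => ?_
  rw [Function.Involutive.coe_toPerm, DegWord.perm_swap_swap, map_smul, map_prod]
  congr 1
  refine Fintype.prod_equiv (Equiv.swap i j) _ _ fun l => ?_
  simp [DegWord.perm]

theorem sum_refl_polyOf {k : ℕ} (v : EuclideanSpace ℝ (DegWord n k)) :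
    ∑ i, ∑ j, (if j = i then 0 else refl i j (polyOf v)) = polyOf (swapSum n k v) := by
  simp only [rename_polyOf]
  rw [polyOf]
  simp only [swapSum_apply, Complex.ofReal_sum, Finset.sum_smul]
  symm
  rw [Finset.sum_comm]
  refine Finset.sum_congr rfl fun i _ => ?_
  rw [Finset.sum_comm]
  refine Finset.sum_congr rfl fun j _ => ?_
  split_ifs <;> simp

theorem exists_polyOf {k : ℕ} {q : Poly n} (hq : q ∈ realHomog n k) :
    ∃ v : EuclideanSpace ℝ (DegWord n k), polyOf v = q := by
  refine ⟨WithLp.toLp 2 fun u =>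
    (coeff (Finsupp.equivFunOnFinite.symm fun l => (u.1 l : ℕ)) q).re, ?_⟩
  have hm : ∀ u : DegWord n k, (∏ l, X l ^ (u.1 l : ℕ) : Poly n)
      = monomial (Finsupp.equivFunOnFinite.symm fun l => (u.1 l : ℕ)) 1 := by
    intro u
    rw [monomial_eq, C_1, one_mul, Finsupp.prod_fintype _ _ (fun _ => pow_zero _)]
    simp
  have hre : ∀ a, ((coeff a q).re : ℂ) = coeff a q := by
    intro a
    have h := congrArg (coeff a) hq.2
    rw [coeff_map] at h
    exact Complex.conj_eq_iff_re.mp h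
  ext a
  simp only [polyOf, hm, coeff_sum, coeff_smul, coeff_monomial, hre, smul_eq_mul, mul_ite, mul_one,
    mul_zero]
  by_cases ha : ∑ l, a l = k
  · have hlt : ∀ l, a l < k + 1 := fun l => by
      have := Finset.single_le_sum (fun i _ => Nat.zero_le (a i)) (Finset.mem_univ l)
      omega
    rw [Finset.sum_eq_single (⟨fun l => ⟨a l, hlt l⟩, ha⟩ : DegWord n k)]
    · have : (Finsupp.equivFunOnFinite.symm fun l => a l) = a := by ext; simp
      simp [this]
    · intro u _ hu
      refine if_neg fun e => hu ?_
      apply Subtype.ext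
      funext l
      apply Fin.ext
      simp [← e]
    · simp
  · rw [Finset.sum_eq_zero]
    · symm
      by_contra h
      refine ha ?_
      rw [hq.1.degree_eq_sum_deg_support (mem_support_iff.mpr h)]
      exact (Finset.sum_subset (Finset.subset_univ _) fun i _ hi =>
        Finsupp.notMem_support_iff.mp hi).symm
    · intro u _
      refine if_neg fun e => ha ?_
      rw [← e]
      refine Eq.trans ?_ u.2
      simp

/-- Real homogeneous polynomials decompose into eigenvectors of the class sum of transpositions,
with eigenvalues bounded below by the degree. -/
theorem exists_eigen_decomposition {k : ℕ} {q : Poly n} (hq : q ∈ realHomog n k) :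
    ∃ (s : Finset ℝ) (g : ℝ → Poly n), (∀ a, g a ∈ realHomog n k) ∧
      (∀ a ∈ s, ∑ i, ∑ j, (if j = i then 0 else refl i j (g a)) = (a : ℂ) • g a) ∧
      (∀ a ∈ s, -(2 * k : ℝ) ≤ a) ∧ q = ∑ a ∈ s, g a := by
  obtain ⟨v, rfl⟩ := exists_polyOf hq
  have htop : (⨆ a, Module.End.eigenspace (swapSum n k) a) = ⊤ :=
    Submodule.orthogonal_eq_bot_iff.mp
      (swapSum_isSymmetric n k).orthogonalComplement_iSup_eigenspaces_eq_bot
  have hv : v ∈ ⨆ a, Module.End.eigenspace (swapSum n k) a := by rw [htop]; trivial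
  obtain ⟨f, hf, hsum⟩ := (Submodule.mem_iSup_iff_exists_finsupp _ _).mp hv
  have he : ∀ a, swapSum n k (f a) = a • f a := fun a => Module.End.mem_eigenspace_iff.mp (hf a)
  refine ⟨f.support, fun a => polyOf (f a), fun a => polyOf_mem _, fun a _ => ?_, fun a ha => ?_, ?_⟩
  · rw [sum_refl_polyOf, he, polyOf_smul]
  · exact neg_two_mul_le_of_swapSum_eq (Finsupp.mem_support_iff.mp ha) (he a)
  · rw [← hsum, Finsupp.sum, polyOf_sum]

/-! ### Definiteness of the Dunkl form on harmonic polynomials -/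

theorem two_mul_vandDeg (n : ℕ) :
    ∑ i : Fin n, ∑ j : Fin n, (if j = i then (0 : ℂ) else 1) = 2 * vandDeg n := by
  have h : ∀ i : Fin n, ∑ j : Fin n, (if j = i then (0 : ℂ) else 1) = (n : ℂ) - 1 := by
    intro i
    have h1 : ∀ j : Fin n, (if j = i then (0 : ℂ) else 1) = 1 - if j = i then 1 else 0 := by
      intro j
      split_ifs <;> simp
    simp only [h1]
    rw [Finset.sum_sub_distrib, Finset.sum_ite_eq', if_pos (Finset.mem_univ _)]
    simp
  simp only [h]
  have h2 := Finset.sum_range_id_mul_two n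
  rw [Finset.sum_range] at h2
  change vandDeg n * 2 = _ at h2
  rcases Nat.eq_zero_or_pos n with rfl | hp
  · simp [vandDeg]
  · have h3 := congrArg (Nat.cast : ℕ → ℂ) h2
    push_cast [Nat.cast_sub (Nat.succ_le_of_lt hp)] at h3
    simp only [Finset.sum_const, Finset.card_univ, Fintype.card_fin, nsmul_eq_mul]
    linear_combination -h3

/-- Antisymmetry of `δ` turns `s_{ij}` on `Φ(q)δ` into `-s_{ij}` on `q`, so the reflection term
becomes the number `2N` of ordered pairs plus the eigenvalue `a`. -/
theorem sum_X_mul_dunklBar_fourierPoly (c : ℝ) {d k : ℕ} (hd : d + k = vandDeg n) {q : Poly n}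
    (hq : q.IsHomogeneous k) {a : ℂ}
    (ha : ∑ i, ∑ j, (if j = i then 0 else refl i j q) = a • q) :
    ∑ i, res n (X i) * dunklBar c i (fourierPoly n c q (vandermonde n))
      = ((d : ℂ) - c / 2 * (2 * vandDeg n + a)) • fourierPoly n c q (vandermonde n) := by
  obtain ⟨⟨g, hg, e⟩, -⟩ := exists_fourierPoly_eq_res c hq (vandermonde_mem_realRes (n := n))
  have hdk : vandDeg n - k = d := by omega
  rw [hdk] at hg
  have h1 := sum_X_mul_dunklBar (c : ℂ) hg
  rw [← e] at h1
  have h2 : ∑ i, ∑ j, (fourierPoly n c q (vandermonde n)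
      - permAct (Equiv.swap i j) (fourierPoly n c q (vandermonde n)))
      = (2 * vandDeg n + a) • fourierPoly n c q (vandermonde n) := by
    have h3 : ∀ i j : Fin n, fourierPoly n c q (vandermonde n)
        - permAct (Equiv.swap i j) (fourierPoly n c q (vandermonde n))
        = (if j = i then (0 : ℂ) else 1) • fourierPoly n c q (vandermonde n)
          + fourierPoly n c (if j = i then 0 else refl i j q) (vandermonde n) := by
      intro i j
      split_ifs with h
      · subst h
        rw [permAct_fourierPoly_vandermonde, Equiv.swap_self]
        simp [sgn]
      · rw [permAct_fourierPoly_vandermonde, sgn_swap (Ne.symm h), neg_one_smul, sub_neg_eq_add,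
          one_smul]
    simp only [h3, Finset.sum_add_distrib]
    simp only [← Finset.sum_smul, two_mul_vandDeg]
    rw [add_smul]
    congr 1
    have h4 := congrArg (fun p => fourierPoly n c p (vandermonde n)) ha
    simp only [map_sum, LinearMap.sum_apply, map_smul, LinearMap.smul_apply] at h4
    exact h4
  rw [h1, h2, smul_smul, ← sub_smul]

theorem X_mul_mem_realHomog (i : Fin n) {k : ℕ} {q : Poly n} (hq : q ∈ realHomog n k) :
    X i * q ∈ realHomog n (k + 1) := by
  refine ⟨?_, by rw [map_mul, map_X, hq.2]⟩
  rw [add_comm]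
  exact (isHomogeneous_X _ _).mul hq.1

/-- Induction on the degree `d` of `Φ(q)δ`. After splitting `q` into eigenvectors of the class sum,
the negative Euler eigenvalue relates `(F, F)` to the forms of the `YᵢF` one degree lower. -/
theorem dunklForm_definite {c : ℝ} (hc : 1 < c) {d k : ℕ} (hd : d + k = vandDeg n) {q : Poly n}
    (hq : q ∈ realHomog n k) :
    ∃ r : ℝ, 0 ≤ r ∧ dunklForm n c (fourierPoly n c q (vandermonde n))
      (fourierPoly n c q (vandermonde n)) = (-1) ^ d * (r : ℂ) ∧
      (r = 0 → fourierPoly n c q (vandermonde n) = 0) := by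
  induction d generalizing k q with
  | zero =>
    obtain ⟨g, hg, e⟩ := (fourierPoly_mem_realRes c hq (vandermonde_mem_realRes (n := n))).1
    have hk : vandDeg n - k = 0 := by omega
    rw [hk] at hg
    have hC := eq_C_of_isHomogeneous_zero hg.1
    have h := hg.2
    rw [hC, map_C] at h
    obtain ⟨x, hx⟩ := Complex.conj_eq_iff_real.mp (C_injective _ _ h)
    rw [hx] at hC
    have e' : fourierPoly n c q (vandermonde n) = algebraMap ℂ _ (x : ℂ) := by
      rw [← e, hC]
      rfl
    refine ⟨x ^ 2, sq_nonneg x, ?_, fun h0 => ?_⟩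
    · rw [e', dunklForm_algebraMap_left, AlgHom.commutes]
      push_cast
      simp [pow_two]
    · have : x = 0 := by simpa using h0
      rw [e', this, Complex.ofReal_zero, map_zero]
  | succ d ih =>
    obtain ⟨s, g, hg, heig, hbd, rfl⟩ := exists_eigen_decomposition hq
    set F : ℝ → CoordRing n := fun a => fourierPoly n c (g a) (vandermonde n) with hF
    set l : ℝ → ℝ := fun a => ((d + 1 : ℕ) : ℝ) - c / 2 * (2 * vandDeg n + a) with hl
    have hlF : ∀ a ∈ s, ∑ i, res n (X i) * dunklBar c i (F a) = (l a : ℂ) • F a := by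
      intro a ha
      rw [hF, sum_X_mul_dunklBar_fourierPoly c hd (hg a).1 (heig a ha)]
      congr 1
      simp only [hl]
      push_cast
      ring
    -- From `a ≥ -2k` and `N = d + 1 + k` one gets `l a ≤ (1 - c)(d + 1)`; this is where `c > 1` is
    -- decisive.
    have hlneg : ∀ a ∈ s, l a < 0 := by
      intro a ha
      have h1 := hbd a ha
      have h2 : (vandDeg n : ℝ) = d + 1 + k := by rw [← hd]; push_cast; ring
      simp only [hl]
      rw [h2]
      push_cast
      have h3 : (0 : ℝ) ≤ d := Nat.cast_nonneg d
      nlinarith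
    have hleft : ∀ a ∈ s, ∀ b, (l a : ℂ) * dunklForm n c (F a) (F b)
        = ∑ i, dunklForm n c (dunklBar c i (F a)) (dunklBar c i (F b)) := by
      intro a ha b
      rw [← smul_eq_mul, ← LinearMap.smul_apply, ← map_smul, ← hlF a ha, map_sum,
        LinearMap.sum_apply]
      simp only [dunklForm_X_mul_left]
    -- The operator `∑ xᵢYᵢ` is self-adjoint, and `a ↦ l a` is injective because `c ≠ 0`.
    have horth : ∀ a ∈ s, ∀ b ∈ s, a ≠ b → dunklForm n c (F a) (F b) = 0 := by
      intro a ha b hb hab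
      have h1 := hleft a ha b
      have h2 := hleft b hb a
      simp only [dunklForm_comm (c : ℂ) _ (dunklBar c _ (F a))] at h2
      rw [dunklForm_comm (c : ℂ) (F b) (F a), ← h1] at h2
      have h3 : ((l b : ℂ) - l a) * dunklForm n c (F a) (F b) = 0 := by
        rw [sub_mul, h2, sub_self]
      refine (mul_eq_zero.mp h3).resolve_left ?_
      rw [← Complex.ofReal_sub, Complex.ofReal_eq_zero]
      simp only [hl]
      intro h4
      have h5 : c * (a - b) = 0 := by linear_combination 2 * h4
      rcases mul_eq_zero.mp h5 with h6 | h6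
      · linarith
      · exact hab (sub_eq_zero.mp h6)
    have hself : ∀ a ∈ s, ∃ r : ℝ, 0 ≤ r ∧ dunklForm n c (F a) (F a) = (-1) ^ (d + 1) * (r : ℂ) ∧
        (r = 0 → F a = 0) := by
      intro a ha
      have hi := fun i => ih (by omega) (X_mul_mem_realHomog i (hg a))
      simp only [fourierPoly_X_mul] at hi
      choose r hr0 hr1 hr2 using hi
      have hln := hlneg a ha
      have hl0 : (l a : ℂ) ≠ 0 := Complex.ofReal_ne_zero.mpr hln.ne
      refine ⟨(∑ i, r i) / (- l a), div_nonneg (Finset.sum_nonneg fun i _ => hr0 i) (by linarith),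
        ?_, fun h0 => ?_⟩
      · apply mul_left_cancel₀ hl0
        rw [hleft a ha a]
        simp only [hF, hr1]
        rw [← Finset.mul_sum]
        push_cast
        field_simp
        ring
      · have h1 : ∑ i, r i = 0 := by
          rcases div_eq_zero_iff.mp h0 with h | h
          · exact h
          · linarith
        rw [Finset.sum_eq_zero_iff_of_nonneg fun i _ => hr0 i] at h1
        have h2 := hlF a ha
        -- If every `YᵢF` vanishes, the Euler identity reads `0 = l F` with `l ≠ 0`.
        rw [Finset.sum_eq_zero] at h2
        · exact (smul_eq_zero.mp h2.symm).resolve_left hl0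
        · intro i hi
          simp only [hF]
          rw [hr2 i (h1 i hi), mul_zero]
    choose! r hr0 hr1 hr2 using hself
    have hsum : fourierPoly n c (∑ a ∈ s, g a) (vandermonde n) = ∑ a ∈ s, F a := by
      rw [map_sum, LinearMap.sum_apply]
    rw [hsum]
    refine ⟨∑ a ∈ s, r a, Finset.sum_nonneg hr0, ?_, fun h0 => ?_⟩
    · rw [map_sum, Complex.ofReal_sum, Finset.mul_sum]
      refine Finset.sum_congr rfl fun a ha => ?_
      rw [map_sum, LinearMap.sum_apply, Finset.sum_eq_single_of_mem a ha, hr1 a ha]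
      exact fun b hb hba => horth b hb a ha hba
    · rw [Finset.sum_eq_zero_iff_of_nonneg hr0] at h0
      exact Finset.sum_eq_zero fun a ha => hr2 a ha (h0 a ha)

theorem dunklForm_vandermonde_ne_zero {c : ℝ} (hc : 1 < c) :
    dunklForm n c (vandermonde n) (vandermonde n) ≠ 0 := by
  have h1 : (1 : Poly n) ∈ realHomog n 0 := ⟨isHomogeneous_one _ _, map_one _⟩
  obtain ⟨r, -, hr, h0⟩ := dunklForm_definite hc (add_zero _) h1
  rw [map_one, Module.End.one_apply] at hr h0
  rw [hr]
  exact mul_ne_zero (pow_ne_zero _ (by norm_num))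
    (Complex.ofReal_ne_zero.mpr fun h => vandermonde_ne_zero (h0 h))

theorem dunklForm_res_eq_zero (c : ℝ) {d e : ℕ} (hde : d ≠ e) {f g : Poly n}
    (hf : f.IsHomogeneous d) (hg : g.IsHomogeneous e) : dunklForm n c (res n f) (res n g) = 0 := by
  have hreal : ∀ g ∈ realHomog n e, dunklForm n c (res n f) (res n g) = 0 := by
    intro g hg
    obtain ⟨⟨p, hp, h1⟩, h2⟩ := exists_fourierPoly_eq_res c hf ⟨g, hg, rfl⟩
    simp only [LinearMap.restrictScalars_apply, AlgHom.toLinearMap_apply] at h1 h2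
    rw [dunklForm_apply, fourier_res]
    rcases lt_or_gt_of_ne hde with h | h
    · rw [h1, evalZero_res, constantCoeff_eq]
      exact hp.coeff_eq_zero (by rw [map_zero]; omega)
    · rw [h2 h, map_zero]
  obtain ⟨g₁, h₁, g₂, h₂, rfl⟩ := exists_real_imag hg
  rw [map_add, map_smul, map_add, map_smul, hreal g₁ h₁, hreal g₂ h₂, smul_zero, add_zero]

theorem fourierPoly_vandermonde_orthogonal (c : ℝ) {k l : ℕ} (hkl : k ≠ l) {p q : Poly n}
    (hp : p.IsHomogeneous k) (hq : q.IsHomogeneous l) :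
    dunklForm n c (fourierPoly n c p (vandermonde n)) (fourierPoly n c q (vandermonde n)) = 0 := by
  obtain ⟨⟨f, hf, ef⟩, zf⟩ := exists_fourierPoly_eq_res c hp (vandermonde_mem_realRes (n := n))
  obtain ⟨⟨g, hg, eg⟩, zg⟩ := exists_fourierPoly_eq_res c hq (vandermonde_mem_realRes (n := n))
  rcases Nat.lt_or_ge (vandDeg n) k with h | h
  · rw [zf h, map_zero, LinearMap.zero_apply]
  rcases Nat.lt_or_ge (vandDeg n) l with h' | h'
  · rw [zg h', map_zero]
  rw [ef, eg]
  exact dunklForm_res_eq_zero c (by omega) hf hg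

/-- Such an `h` is orthogonal to all of `ℋ_c`, and so is each homogeneous component, since distinct
degrees are orthogonal. Definiteness then applies to real and imaginary parts. -/
theorem eq_zero_of_mem_invariantIdeal_of_mem_harmonic {c : ℝ} (hc : 1 < c) {h : CoordRing n}
    (ha : h ∈ invariantIdeal n) (hh : h ∈ harmonic n c) : h = 0 := by
  obtain ⟨f, rfl⟩ := (mem_harmonic_iff _ _).mp hh
  obtain ⟨q, rfl⟩ := res_surjective n f
  rw [fourier_res] at ha ⊢
  have hsum : fourierPoly n c q (vandermonde n) = ∑ k ∈ Finset.range (q.totalDegree + 1),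
      fourierPoly n c (homogeneousComponent k q) (vandermonde n) := by
    conv_lhs => rw [← sum_homogeneousComponent q]
    rw [map_sum, LinearMap.sum_apply]
  rw [hsum]
  refine Finset.sum_eq_zero fun k hk => ?_
  rcases Nat.lt_or_ge (vandDeg n) k with hk' | hk'
  · exact (exists_fourierPoly_eq_res c (homogeneousComponent_isHomogeneous k q)
      (vandermonde_mem_realRes (n := n))).2 hk'
  have horth : ∀ p : Poly n, p.IsHomogeneous k → dunklForm n c (fourierPoly n c p (vandermonde n))
      (fourierPoly n c (homogeneousComponent k q) (vandermonde n)) = 0 := by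
    intro p hp
    have h1 : dunklForm n c (fourierPoly n c p (vandermonde n))
        (fourierPoly n c q (vandermonde n)) = 0 := by
      rw [dunklForm_comm]
      exact dunklForm_eq_zero_of_mem c ha ((mem_harmonic_iff _ _).mpr ⟨res n p, rfl⟩)
    rw [hsum, map_sum, Finset.sum_eq_single_of_mem k hk] at h1
    · exact h1
    · intro l _ hl
      exact fourierPoly_vandermonde_orthogonal c hl.symm hp
        (homogeneousComponent_isHomogeneous l q)
  obtain ⟨q₁, hq₁, q₂, hq₂, e⟩ := exists_real_imag (homogeneousComponent_isHomogeneous k q)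
  obtain ⟨r₁, p₁, e₁, z₁⟩ := dunklForm_definite hc (Nat.sub_add_cancel hk') hq₁
  obtain ⟨r₂, p₂, e₂, z₂⟩ := dunklForm_definite hc (Nat.sub_add_cancel hk') hq₂
  have e' : fourierPoly n c (homogeneousComponent k q) (vandermonde n)
      = fourierPoly n c q₁ (vandermonde n) + Complex.I • fourierPoly n c q₂ (vandermonde n) := by
    rw [e, map_add, map_smul, LinearMap.add_apply, LinearMap.smul_apply]
  have o₁ := horth q₁ hq₁.1
  have o₂ := horth q₂ hq₂.1
  rw [e', map_add, map_smul, smul_eq_mul] at o₁ o₂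
  rw [dunklForm_comm (c : ℂ) (fourierPoly n c q₂ (vandermonde n))
    (fourierPoly n c q₁ (vandermonde n))] at o₂
  rw [e₁] at o₁
  rw [e₂] at o₂
  -- The form is bilinear, not Hermitian: pairing `F₁ + iF₂` with its conjugate `F₁ - iF₂` gives
  -- `(F₁, F₁) + (F₂, F₂)`.
  have hr : ((-1 : ℂ) ^ (vandDeg n - k)) * ((r₁ + r₂ : ℝ) : ℂ) = 0 := by
    push_cast
    linear_combination o₁ - Complex.I * o₂
      + (-1 : ℂ) ^ (vandDeg n - k) * r₂ * Complex.I_sq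
  have hr' : r₁ + r₂ = 0 := by
    have := (mul_eq_zero.mp hr).resolve_left (pow_ne_zero _ (by norm_num))
    exact_mod_cast this
  rw [e', z₁ (by linarith), z₂ (by linarith), smul_zero, add_zero]

/-! ### Dual bases for the coinvariant algebra -/

/-- Exponents below the staircase. -/
abbrev Stair (n : ℕ) := (j : Fin n) → Fin (j + 1)

theorem card_stair (n : ℕ) : Fintype.card (Stair n) = n ! := by
  rw [Fintype.card_pi]
  simp only [Fintype.card_fin]
  rw [← Finset.prod_range_add_one_eq_factorial, Finset.prod_range]

/-- The monomials below the staircase. -/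
def stairMonomial (b : Stair n) : Poly n := ∏ j, X j ^ (b j : ℕ)

/-- The polynomial `∏_{i < j} (xᵢ - t)`. -/
def partialProd (j : Fin n) : Polynomial (Poly n) :=
  ∏ i ∈ Finset.Iio j, (Polynomial.C (X i) - Polynomial.X)

theorem natDegree_partialProd_lt (j : Fin n) : (partialProd j).natDegree < j + 1 := by
  rw [Nat.lt_succ_iff, partialProd]
  refine (Polynomial.natDegree_prod_le _ _).trans ?_
  have h : ∀ i ∈ Finset.Iio j, (Polynomial.C (X i : Poly n) - Polynomial.X).natDegree ≤ 1 := by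
    intro i _
    refine (Polynomial.natDegree_sub_le _ _).trans ?_
    simp
  refine (Finset.sum_le_card_nsmul _ _ _ h).trans ?_
  simp

/-- The coefficients of `∏_{i < j} (xᵢ - zⱼ)` as a polynomial in the `zⱼ`. -/
def dualCoeff (b : Stair n) : Poly n := ∏ j, (partialProd j).coeff (b j)

/-- Expand each `∏_{i<j} (x_{v(i)} - x_{w(j)})` in powers of `x_{w(j)}`; its degree in that variable
is at most `j`, which is what produces the staircase. -/
theorem sum_dualCoeff_mul (v w : Equiv.Perm (Fin n)) :
    ∑ b : Stair n, rename v (dualCoeff b) * rename w (stairMonomial b)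
      = ∏ j, ∏ i ∈ Finset.Iio j, (X (v i) - X (w j) : Poly n) := by
  have h : ∀ j : Fin n, ∏ i ∈ Finset.Iio j, (X (v i) - X (w j) : Poly n)
      = ∑ b : Fin (j + 1), rename v ((partialProd j).coeff b) * X (w j) ^ (b : ℕ) := by
    intro j
    have h1 : ∏ i ∈ Finset.Iio j, (X (v i) - X (w j) : Poly n)
        = (partialProd j).eval₂ (rename v : Poly n →ₐ[ℂ] Poly n).toRingHom (X (w j)) := by
      rw [partialProd, Polynomial.eval₂_finsetProd]
      refine Finset.prod_congr rfl fun i _ => ?_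
      simp
    rw [h1, Polynomial.eval₂_eq_sum_range' _ (natDegree_partialProd_lt j), Finset.sum_range]
    rfl
  simp only [h]
  rw [Finset.prod_univ_sum]
  simp only [Fintype.piFinset_univ]
  refine Finset.sum_congr rfl fun b _ => ?_
  rw [dualCoeff, stairMonomial, map_prod, map_prod, ← Finset.prod_mul_distrib]
  refine Finset.prod_congr rfl fun j _ => ?_
  rw [map_pow, rename_X]

theorem exists_lt_of_ne_one {w : Equiv.Perm (Fin n)} (hw : w ≠ 1) : ∃ j, w j < j := by
  by_contra! h
  have h1 : ∑ j, ((w j : Fin n) : ℕ) = ∑ j : Fin n, (j : ℕ) :=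
    Equiv.sum_comp w fun j : Fin n => (j : ℕ)
  have h2 := (Finset.sum_eq_sum_iff_of_le fun j _ => Fin.le_def.mp (h j)).mp h1.symm
  refine hw (Equiv.ext fun j => ?_)
  exact Fin.ext (h2 j (Finset.mem_univ j)).symm

/-- Since `v⁻¹w ≠ 1` lowers some `j`, the factor with `i = v⁻¹w(j) < j` is zero. -/
theorem sum_dualCoeff_mul_of_ne {v w : Equiv.Perm (Fin n)} (h : v ≠ w) :
    ∑ b : Stair n, rename v (dualCoeff b) * rename w (stairMonomial b) = 0 := by
  rw [sum_dualCoeff_mul]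
  have h1 : v⁻¹ * w ≠ 1 := fun e => h (inv_mul_eq_one.mp e)
  obtain ⟨j, hj⟩ := exists_lt_of_ne_one h1
  refine Finset.prod_eq_zero (Finset.mem_univ j)
    (Finset.prod_eq_zero (Finset.mem_Iio.mpr hj) ?_)
  simp

theorem sum_dualCoeff_mul_self (w : Equiv.Perm (Fin n)) :
    ∑ b : Stair n, rename w (dualCoeff b) * rename w (stairMonomial b) = sgn w • vander n := by
  rw [sum_dualCoeff_mul, ← rename_vander, vander_eq, map_prod]
  simp only [map_prod, map_sub, rename_X]

/-- Only the identity permutation survives in the alternating sum. Dividing by `δ` writes `f` as a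
combination of staircase monomials with symmetric coefficients. -/
theorem sum_alt_mul_stairMonomial (f : Poly n) :
    ∑ b : Stair n, alt (f * dualCoeff b) * stairMonomial b = f * vander n := by
  simp only [alt_apply, Finset.sum_mul]
  rw [Finset.sum_comm]
  have h : ∀ w : Equiv.Perm (Fin n),
      ∑ b : Stair n, (sgn w • rename w (f * dualCoeff b)) * stairMonomial b
        = (sgn w • rename w f) * ∑ b : Stair n, rename w (dualCoeff b) *
          rename (1 : Equiv.Perm (Fin n)) (stairMonomial b) := by
    intro w
    rw [Finset.mul_sum]
    refine Finset.sum_congr rfl fun b _ => ?_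
    rw [map_mul, Equiv.Perm.coe_one, rename_id_apply, smul_mul_assoc, smul_mul_assoc, mul_assoc]
  simp only [h]
  rw [Finset.sum_eq_single 1]
  · rw [sum_dualCoeff_mul_self, sgn_one, one_smul, one_smul, Equiv.Perm.coe_one, rename_id_apply]
  · intro w _ hw
    rw [sum_dualCoeff_mul_of_ne hw, mul_zero]
  · simp

/-- The previous sums say that two matrices over the fraction field satisfy `V A = 1`. Both index
sets have `n!` elements, so `A V = 1`, which is the claim. -/
theorem alt_dualCoeff_mul (a b : Stair n) :
    alt (dualCoeff a * stairMonomial b) = if a = b then vander n else 0 := by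
  classical
  set ψ := algebraMap (Poly n) (FractionRing (Poly n)) with hψ
  have hinj : Function.Injective ψ := IsFractionRing.injective _ _
  have hD : ψ (vander n) ≠ 0 := fun h => vander_ne_zero (hinj (by rw [h, map_zero]))
  let V : Matrix (Equiv.Perm (Fin n)) (Stair n) (FractionRing (Poly n)) :=
    Matrix.of fun w b => ψ (rename w (stairMonomial b))
  let A : Matrix (Stair n) (Equiv.Perm (Fin n)) (FractionRing (Poly n)) :=
    Matrix.of fun b w => (ψ (vander n))⁻¹ * ψ (sgn w • rename w (dualCoeff b))
  have hVA : V * A = 1 := by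
    ext w v
    rw [Matrix.mul_apply]
    have h : ∀ b : Stair n, V w b * A b v = (ψ (vander n))⁻¹ *
        ψ (sgn v • (rename v (dualCoeff b) * rename w (stairMonomial b))) := by
      intro b
      simp only [V, A, Matrix.of_apply]
      rw [← smul_mul_assoc, map_mul]
      ring
    simp only [h]
    rw [← Finset.mul_sum, ← map_sum, ← Finset.smul_sum]
    by_cases e : w = v
    · subst e
      rw [sum_dualCoeff_mul_self, smul_smul, sgn_mul_self, one_smul, inv_mul_cancel₀ hD,
        Matrix.one_apply_eq]
    · rw [sum_dualCoeff_mul_of_ne (Ne.symm e), smul_zero, map_zero, mul_zero,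
        Matrix.one_apply_ne e]
  have hcard : Fintype.card (Equiv.Perm (Fin n)) = Fintype.card (Stair n) := by
    rw [card_stair, Fintype.card_perm, Fintype.card_fin]
  have hAV : A * V = 1 := (Matrix.mul_eq_one_comm_of_equiv (Fintype.equivOfCardEq hcard)).mp hVA
  have h := congrFun (congrFun hAV a) b
  rw [Matrix.mul_apply, Matrix.one_apply] at h
  apply hinj
  rw [alt_apply, map_sum]
  have h1 : ∀ w, ψ (sgn w • rename w (dualCoeff a * stairMonomial b))
      = ψ (vander n) * (A a w * V w b) := by
    intro w
    simp only [V, A, Matrix.of_apply]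
    rw [map_mul (rename w), ← smul_mul_assoc, map_mul]
    field_simp
  simp only [h1]
  rw [← Finset.mul_sum, h]
  split_ifs <;> simp

/-! ### Antisymmetric polynomials are divisible by the Vandermonde determinant -/

theorem X_sub_X_dvd_of_refl {i j : Fin n} {f : Poly n} (hf : refl i j f = -f) :
    (X i - X j : Poly n) ∣ f := by
  have h1 := sub_dvd_sub_refl i j f
  rw [hf, sub_neg_eq_add, ← two_mul] at h1
  have h2 : f = C (1 / 2 : ℂ) * (2 * f) := by
    have : (2 : Poly n) = C (2 : ℂ) := (map_ofNat C 2).symm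
    rw [this, ← mul_assoc, ← C_mul]
    norm_num
  rw [h2]
  exact Dvd.dvd.mul_left h1 _

/-- Substituting `xⱼ` for `xᵢ`. -/
def subst (i j : Fin n) : Poly n →ₐ[ℂ] Poly n := aeval fun k => if k = i then X j else X k

theorem X_sub_X_dvd_iff {i j : Fin n} (f : Poly n) :
    (X i - X j : Poly n) ∣ f ↔ subst i j f = 0 := by
  have hd : (X i - X j : Poly n) ∣ f - subst i j f := by
    rw [← Ideal.mem_span_singleton, ← Ideal.Quotient.eq]
    have key : Ideal.Quotient.mkₐ ℂ (Ideal.span {(X i - X j : Poly n)})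
        = (Ideal.Quotient.mkₐ ℂ (Ideal.span {(X i - X j : Poly n)})).comp (subst i j) := by
      apply MvPolynomial.algHom_ext
      intro k
      simp only [AlgHom.comp_apply, subst, aeval_X, Ideal.Quotient.mkₐ_eq_mk]
      split_ifs with h
      · subst h
        rw [Ideal.Quotient.eq]
        exact Ideal.mem_span_singleton_self _
      · rfl
    exact DFunLike.congr_fun key f
  constructor
  · rintro ⟨g, rfl⟩
    rw [map_mul]
    simp [subst]
  · intro h
    rwa [h, sub_zero] at hd

theorem prime_X_sub_X {i j : Fin n} (h : i ≠ j) : Prime (X i - X j : Poly n) := by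
  refine ⟨X_sub_X_ne_zero h, fun hu => ?_, fun f g hfg => ?_⟩
  · have h1 := (X_sub_X_dvd_iff (i := i) (j := j) 1).mp (isUnit_iff_dvd_one.mp hu)
    rw [map_one] at h1
    exact one_ne_zero h1
  · rw [X_sub_X_dvd_iff, map_mul, mul_eq_zero] at hfg
    rwa [X_sub_X_dvd_iff, X_sub_X_dvd_iff]

theorem isRelPrime_X_sub_X {i j k l : Fin n} (hij : i < j) (hkl : k < l)
    (h : (i, j) ≠ (k, l)) : IsRelPrime (X i - X j : Poly n) (X k - X l) := by
  refine (prime_X_sub_X hij.ne).irreducible.isRelPrime_iff_not_dvd.mpr fun hd => ?_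
  rw [X_sub_X_dvd_iff, map_sub, sub_eq_zero] at hd
  simp only [subst, aeval_X] at hd
  split_ifs at hd with h1 h2 h2 <;> have h3 := X_injective hd
  · exact hkl.ne (h1.trans h2.symm)
  · subst h1
    exact h (Prod.ext rfl h3)
  · subst h2
    subst h3
    exact lt_asymm hij hkl
  · exact hkl.ne h3

/-- Each `xᵢ - xⱼ` divides `f`, and these are pairwise non-associated primes. -/
theorem vander_dvd {f : Poly n} (hf : ∀ w : Equiv.Perm (Fin n), rename w f = sgn w • f) :
    vander n ∣ f := by
  have e : vander n = ∏ p ∈ Finset.univ.sigma (fun i : Fin n => Finset.Ioi i),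
      (X p.1 - X p.2 : Poly n) := by
    rw [vander, Finset.prod_sigma]
  rw [e]
  refine Finset.prod_dvd_of_isRelPrime ?_ ?_
  · intro p hp q hq hpq
    simp only [Finset.coe_sigma, Set.mem_sigma_iff, Finset.mem_coe, Finset.mem_Ioi] at hp hq
    refine isRelPrime_X_sub_X hp.2 hq.2 fun h => hpq ?_
    rw [Prod.mk.injEq] at h
    exact Sigma.ext h.1 (heq_of_eq h.2)
  · intro p hp
    rw [Finset.mem_sigma, Finset.mem_Ioi] at hp
    refine X_sub_X_dvd_of_refl ?_
    rw [refl, hf, sgn_swap hp.2.ne, neg_one_smul]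

theorem exists_alt_eq (f : Poly n) :
    ∃ s : Poly n, (∀ w : Equiv.Perm (Fin n), rename w s = s) ∧ alt f = vander n * s := by
  obtain ⟨s, hs⟩ := vander_dvd (f := alt f) fun w => rename_alt w f
  refine ⟨s, fun w => ?_, hs⟩
  have h := rename_alt w f
  rw [hs, map_mul, rename_vander, smul_mul_assoc] at h
  have hne : sgn w ≠ 0 := fun h0 => by simpa [h0] using sgn_mul_self w
  have h1 := smul_right_injective (Poly n) hne h
  exact mul_left_cancel₀ vander_ne_zero h1

/-! ### The coinvariant algebra -/

theorem dunklForm_alt (c : ℝ) (f : Poly n) :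
    dunklForm n c (res n (alt f)) (vandermonde n)
      = n ! * dunklForm n c (res n f) (vandermonde n) := by
  rw [alt_apply, map_sum, map_sum, LinearMap.sum_apply]
  have h : ∀ w : Equiv.Perm (Fin n), dunklForm n c (res n (sgn w • rename w f)) (vandermonde n)
      = dunklForm n c (res n f) (vandermonde n) := by
    intro w
    rw [← dunklForm_permAct (c : ℂ) w (res n f), permAct_vandermonde, permAct_res, map_smul,
      map_smul, map_smul, LinearMap.smul_apply]
  simp only [h]
  rw [Finset.sum_const, Finset.card_univ, Fintype.card_perm, Fintype.card_fin, nsmul_eq_mul]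

/-- The invariant `s - s(0)` kills `δ`, so `Φ(s)δ = s(0)δ`. -/
theorem dunklForm_vandermonde_mul (c : ℝ) {s : Poly n}
    (hs : ∀ w : Equiv.Perm (Fin n), rename w s = s) :
    dunklForm n c (res n (vander n * s)) (vandermonde n)
      = constantCoeff s * dunklForm n c (vandermonde n) (vandermonde n) := by
  have h := fourierPoly_vandermonde_eq_zero c (p := s - C (constantCoeff s))
    (fun w => by rw [map_sub, hs, rename_C]) (by simp)
  rw [map_sub, LinearMap.sub_apply, fourierPoly_C, sub_eq_zero] at h
  rw [map_mul, dunklForm_mul_left, fourier_res, h, res_vander, map_smul, smul_eq_mul]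

/-- Expand `f` over staircase monomials with symmetric coefficients `s b`. Pairing `alt(f ·
dualCoeff b) = δ s_b` with `δ` gives `s_b(0)(δ, δ) = n! (f · dualCoeff b, δ) = 0`, so each `s b` has
no constant term. -/
theorem mem_invariantIdeal_of_forall {c : ℝ} (hc : 1 < c) {f : Poly n}
    (h : ∀ g : Poly n, dunklForm n c (res n (f * g)) (vandermonde n) = 0) :
    res n f ∈ invariantIdeal n := by
  choose s hs e using fun b : Stair n => exists_alt_eq (f * dualCoeff b)
  have h0 : ∀ b, constantCoeff (s b) = 0 := by
    intro b
    have h1 := dunklForm_alt c (f * dualCoeff b)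
    rw [h, mul_zero, e, dunklForm_vandermonde_mul c (hs b)] at h1
    exact (mul_eq_zero.mp h1).resolve_right (dunklForm_vandermonde_ne_zero hc)
  have h2 : f = ∑ b, s b * stairMonomial b := by
    apply mul_left_cancel₀ (vander_ne_zero (n := n))
    rw [mul_comm, ← sum_alt_mul_stairMonomial, Finset.mul_sum]
    refine Finset.sum_congr rfl fun b _ => ?_
    rw [e, mul_assoc]
  rw [h2, map_sum]
  refine Ideal.sum_mem _ fun b _ => ?_
  rw [map_mul]
  refine Ideal.mul_mem_right _ _ (Ideal.subset_span ⟨fun w => ?_, ?_⟩)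
  · rw [permAct_res, hs]
  · rw [evalZero_res, h0]

theorem mem_invariantIdeal_iff {c : ℝ} (hc : 1 < c) (f : CoordRing n) :
    f ∈ invariantIdeal n ↔ fourier n c f (vandermonde n) = 0 := by
  refine ⟨fourier_vandermonde_eq_zero c, fun h => ?_⟩
  obtain ⟨f, rfl⟩ := res_surjective n f
  refine mem_invariantIdeal_of_forall hc fun g => ?_
  rw [mul_comm, map_mul, dunklForm_mul_left, h, map_zero]

/-- The surjection `f ↦ Φ_c(f) δ` onto the harmonic polynomials. -/
def toHarmonic (n : ℕ) (c : ℂ) : CoordRing n →ₗ[ℂ] CoordRing n :=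
  (fourier n c).toLinearMap.flip (vandermonde n)

theorem toHarmonic_apply (c : ℂ) (f : CoordRing n) :
    toHarmonic n c f = fourier n c f (vandermonde n) := rfl

theorem range_toHarmonic (c : ℂ) : LinearMap.range (toHarmonic n c) = harmonic n c := by
  ext h
  rw [mem_harmonic_iff, LinearMap.mem_range]
  rfl

theorem ker_toHarmonic {c : ℝ} (hc : 1 < c) :
    LinearMap.ker (toHarmonic n c) = (invariantIdeal n).restrictScalars ℂ := by
  ext f
  rw [LinearMap.mem_ker, toHarmonic_apply, ← mem_invariantIdeal_iff hc]
  rfl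

/-! ### Dimension of `ℋ_c` and the direct sum decomposition -/

theorem res_eq_sum_stairMonomial (f : Poly n) : ∃ a : Stair n → ℂ,
    res n f - ∑ b, a b • res n (stairMonomial b) ∈ invariantIdeal n := by
  choose s hs e using fun b : Stair n => exists_alt_eq (f * dualCoeff b)
  have h2 : f = ∑ b, s b * stairMonomial b := by
    apply mul_left_cancel₀ (vander_ne_zero (n := n))
    rw [mul_comm, ← sum_alt_mul_stairMonomial, Finset.mul_sum]
    refine Finset.sum_congr rfl fun b _ => ?_
    rw [e, mul_assoc]
  refine ⟨fun b => constantCoeff (s b), ?_⟩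
  conv in res n f => rw [h2]
  rw [map_sum, ← Finset.sum_sub_distrib]
  refine Ideal.sum_mem _ fun b _ => ?_
  have h3 : res n (s b * stairMonomial b) - constantCoeff (s b) • res n (stairMonomial b)
      = res n (s b - C (constantCoeff (s b))) * res n (stairMonomial b) := by
    rw [← map_smul, ← map_sub, ← map_mul, smul_eq_C_mul, sub_mul]
  rw [h3]
  refine Ideal.mul_mem_right _ _ (Ideal.subset_span ⟨fun w => ?_, ?_⟩)
  · rw [permAct_res, map_sub, hs, rename_C]
  · rw [evalZero_res]
    simp

/-- The functions `Φ_c(x^β) δ`, for `β` below the staircase. -/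
def harmonicBasisVec (c : ℂ) (b : Stair n) : CoordRing n := toHarmonic n c (res n (stairMonomial b))

theorem span_harmonicBasisVec (c : ℝ) :
    Submodule.span ℂ (Set.range (harmonicBasisVec (n := n) (c : ℂ))) = harmonic n c := by
  rw [← range_toHarmonic]
  apply le_antisymm
  · rw [Submodule.span_le]
    rintro _ ⟨b, rfl⟩
    exact ⟨_, rfl⟩
  · rintro _ ⟨f, rfl⟩
    obtain ⟨f, rfl⟩ := res_surjective n f
    obtain ⟨a, ha⟩ := res_eq_sum_stairMonomial f
    have h := fourier_vandermonde_eq_zero c ha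
    rw [← toHarmonic_apply, map_sub, sub_eq_zero, map_sum] at h
    rw [h]
    refine Submodule.sum_mem _ fun b _ => ?_
    rw [map_smul]
    exact Submodule.smul_mem _ _ (Submodule.subset_span ⟨b, rfl⟩)

/-- Pairing a relation with `dualCoeff b` and antisymmetrizing isolates `a b` times `(δ, δ)`, which
is nonzero. -/
theorem linearIndependent_harmonicBasisVec {c : ℝ} (hc : 1 < c) :
    LinearIndependent ℂ (harmonicBasisVec (n := n) (c : ℂ)) := by
  rw [Fintype.linearIndependent_iff]
  intro a ha b
  have h1 : toHarmonic n c (res n (∑ d, a d • stairMonomial d)) = 0 := by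
    rw [map_sum, map_sum, ← ha]
    simp only [map_smul]
    rfl
  have h2 : dunklForm n c (res n (dualCoeff b * ∑ d, a d • stairMonomial d)) (vandermonde n)
      = 0 := by
    rw [map_mul, dunklForm_mul_left, ← toHarmonic_apply, h1, map_zero]
  have h3 := dunklForm_alt c (dualCoeff b * ∑ d, a d • stairMonomial d)
  rw [h2, mul_zero] at h3
  have h4 : alt (dualCoeff b * ∑ d, a d • stairMonomial d) = a b • vander n := by
    rw [Finset.mul_sum, map_sum]
    simp only [mul_smul_comm, map_smul, alt_dualCoeff_mul]
    simp
  rw [h4, map_smul, map_smul, LinearMap.smul_apply, res_vander, smul_eq_mul] at h3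
  exact (mul_eq_zero.mp h3).resolve_right (dunklForm_vandermonde_ne_zero hc)

theorem finrank_harmonic {c : ℝ} (hc : 1 < c) : Module.finrank ℂ (harmonic n c) = n ! := by
  rw [← span_harmonicBasisVec, finrank_span_eq_card (linearIndependent_harmonicBasisVec hc),
    card_stair]

theorem isCompl_invariantIdeal_harmonic {c : ℝ} (hc : 1 < c) :
    IsCompl ((invariantIdeal n).restrictScalars ℂ) (harmonic n c) := by
  have hdisj : Disjoint ((invariantIdeal n).restrictScalars ℂ) (harmonic n c) := by
    rw [Submodule.disjoint_def]
    intro h ha hh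
    exact eq_zero_of_mem_invariantIdeal_of_mem_harmonic hc ha hh
  have hfin : FiniteDimensional ℂ (harmonic n c) :=
    FiniteDimensional.of_finrank_pos (by rw [finrank_harmonic hc]; positivity)
  -- The map `h ↦ Φ(h)δ` on `ℋ_c` has kernel `𝔞 ∩ ℋ_c = 0`, so it is bijective by finite dimension.
  let T : harmonic n c →ₗ[ℂ] harmonic n c :=
    ((toHarmonic n c).codRestrict (harmonic n c) fun f => by
      rw [← range_toHarmonic]; exact ⟨f, rfl⟩).comp (harmonic n c).subtype
  have hT : Function.Injective T := by
    rw [injective_iff_map_eq_zero]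
    intro h hh
    have h1 : toHarmonic n c h.1 = 0 := congrArg Subtype.val hh
    have h2 : h.1 ∈ (invariantIdeal n).restrictScalars ℂ := by
      rw [← ker_toHarmonic hc]
      exact h1
    exact Subtype.ext (eq_zero_of_mem_invariantIdeal_of_mem_harmonic hc h2 h.2)
  have hTs : Function.Surjective T := LinearMap.surjective_of_injective hT
  refine ⟨hdisj, ?_⟩
  rw [codisjoint_iff, eq_top_iff]
  intro f _
  -- The harmonic part of `f` is the `h ∈ ℋ_c` with `Φ(h)δ = Φ(f)δ`; then `f - h` lies in the kernel
  -- `𝔞`.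
  obtain ⟨h, hh⟩ := hTs ⟨toHarmonic n c f, by rw [← range_toHarmonic]; exact ⟨f, rfl⟩⟩
  have h1 : toHarmonic n c h.1 = toHarmonic n c f := congrArg Subtype.val hh
  have h2 : f - h.1 ∈ (invariantIdeal n).restrictScalars ℂ := by
    rw [← ker_toHarmonic hc, LinearMap.mem_ker, map_sub, h1, sub_self]
  exact Submodule.mem_sup.mpr ⟨_, h2, _, h.2, sub_add_cancel _ _⟩

end Cherednik

end

theorem mainTheorem8 (m n : ℕ) (hn : 0 < n) (hmn : Nat.Coprime m n)
    (hc : 1 < (m : ℚ) / (n : ℚ)) :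
    IsCompl ((Cherednik.invariantIdeal n).restrictScalars ℂ)
        (Cherednik.harmonic n ((m : ℂ) / (n : ℂ))) ∧
      (∀ f ∈ Cherednik.invariantIdeal n, ∀ h ∈ Cherednik.harmonic n ((m : ℂ) / (n : ℂ)),
        Cherednik.dunklForm n ((m : ℂ) / (n : ℂ)) f h = 0 ∧
        Cherednik.dunklForm n ((m : ℂ) / (n : ℂ)) h f = 0) ∧
      Module.finrank ℂ (Cherednik.harmonic n ((m : ℂ) / (n : ℂ))) = n ! := by
  have hc' : (1 : ℝ) < (m : ℝ) / n := by
    have h := (Rat.cast_lt (K := ℝ)).mpr hc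
    push_cast at h
    exact h
  have e : (m : ℂ) / (n : ℂ) = (((m : ℝ) / n : ℝ) : ℂ) := by push_cast; rfl
  rw [e]
  refine ⟨Cherednik.isCompl_invariantIdeal_harmonic hc', fun f hf h hh => ⟨?_, ?_⟩,
    Cherednik.finrank_harmonic hc'⟩
  · exact Cherednik.dunklForm_eq_zero_of_mem _ hf hh
  · rw [Cherednik.dunklForm_comm]
    exact Cherednik.dunklForm_eq_zero_of_mem _ hf hh
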